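/- Let $\rho\in(0,1)$ and $\nu\in\mathbb R$, and put $\rho_0=\sqrt{1-\rho^2}$ and $\alpha_0=\rho e^{i\nu}$. On the Hilbert space $\ell^2(\mathbb Z)\otimes\mathbb C^2$, with orthonormal bases $\{|x\rangle: x\in\mathbb Z\}$ of $\ell^2(\mathbb Z)$ and $\{|0\rangle,|1\rangle\}$ of $\mathbb C^2$, let $U=VU_f$ be the unitary operator given by \begin{align*} V=\sum_{x\in\mathbb Z}\Big[&|x-1\rangle\langle x|\otimes\big(\rho_0\overline{\alpha_0}\,|1\rangle\langle 0|+\rho_0^2\,|1\rangle\langle 1|\big)\\ &+|x\rangle\langle x|\otimes\big(-(1-\rho_0^2)|0\rangle\langle 0|-\alpha_0\rho_0|0\rangle\langle 1|+\rho_0\overline{\alpha_0}\,|1\rangle\langle 0|-(1-\rho_0^2)|1\rangle\langle 1|\big)\\ &+|x+1\rangle\langle x|\otimes\big(\rho_0^2|0\rangle\langle 0|-\alpha_0\rho_0|0\rangle\langle 1|\big)\Big],\\ U_f=\sum_{x\in\mathbb Z}&|x\rangle\langle x|\otimes\big(|0\rangle\langle 1|+|1\rangle\langle 0|\big). \end{align*}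 Let $\alpha,\beta\in\mathbb C$ with $|\alpha|^2+|\beta|^2=1$, let $\Psi_0=|0\rangle\otimes(\alpha|0\rangle+\beta|1\rangle)$ and $\Psi_t=U^t\Psi_0$ for $t=0,1,2,\dots$, and let $X_t$ be a $\mathbb Z$-valued random variable with $\mathbb P(X_t=x)=\|(\langle x|\otimes I)\Psi_t\|^2$. **Theorem.** Assume $(\rho,\nu)\ne(1/\sqrt2,\ \pi/2+n\pi)$ for every $n\in\mathbb Z$. Define \begin{align*} \xi(x)&=(\rho^2-x^2)(\rho_0^2-x^2)-\rho^2\rho_0^2(\cos^2\nu)\,x^2,\\ \eta_\pm(x)&=1-\rho^2\rho_0^2(1+\sin^2\nu)-(1-\rho^2\rho_0^2\cos^2\nu)\,x^2\pm2\rho\rho_0(\sin\nu)\sqrt{\xi(x)},\\ \gamma(x)&=1+\Big\{|\alpha|^2-|\beta|^2-\tfrac{2\rho_0}{\rho}\big(\Re(\alpha\overline\beta)\cos\nu-\Im(\alpha\overline\beta)\sin\nu\big)\Big\}x,\\ h^*&=\tfrac12\Big\{\sqrt{(1+\rho\rho_0)^2-\rho^2\rho_0^2\sin^2\nu}-\sqrt{(1-\rho\rho_0)^2-\rho^2\rho_0^2\sin^2\nu}\Big\}.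 \end{align*} Then $0<h^*<1$; on $(-h^*,h^*)$ one has $\xi>0$ and $\eta_\pm\ge0$; the function $$f(y)=\frac{\sqrt{\eta_+(y)}+\sqrt{\eta_-(y)}}{2\pi(1-y^2)\sqrt{\xi(y)}}\,\gamma(y)\ \text{ for } y\in(-h^*,h^*),\qquad f(y)=0\ \text{ otherwise,}$$ is a probability density on $\mathbb R$; $X_t/t$ converges in distribution, as $t\to\infty$, to the probability law with density $f$; and for every real $x$ $$\lim_{t\to\infty}\mathbb P\Big(\frac{X_t}{t}\le x\Big)=\int_{-\infty}^x f(y)\,dy .$$ -/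

import Mathlib

open MeasureTheory ProbabilityTheory Filter Topology Set
open scoped ENNReal ComplexConjugate

noncomputable section

namespace QWalk

/-! ### The state space and operators on it -/

/-- The coin space `ℂ²`, with orthonormal basis `|0⟩, |1⟩`. -/
abbrev Coin : Type := EuclideanSpace ℂ (Fin 2)

/-- The state space of the walk: the Hilbert space `ℓ²(ℤ) ⊗ ℂ²`, realised as the square-summable
functions `ℤ → ℂ²`. -/
abbrev State : Type := lp (fun _ : ℤ => Coin) 2

/-- The translation `∑ₓ |x + j⟩⟨x| ⊗ 1`. -/
def translate (j : ℤ) : State →L[ℂ] State :=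
  LinearIsometry.toContinuousLinearMap
    { toFun := fun ψ => ⟨fun x => ψ (x - j), memℓp_gen
        ((Equiv.subRight j).summable_iff.mpr ((lp.memℓp ψ).summable (by norm_num)))⟩
      map_add' := fun _ _ => rfl
      map_smul' := fun _ _ => rfl
      norm_map' := fun ψ => by
        have h2 : (0 : ℝ) < (2 : ℝ≥0∞).toReal := by norm_num
        have h := (Equiv.subRight j).tsum_eq (fun x => ‖ψ x‖ ^ (2 : ℝ≥0∞).toReal)
        rw [lp.norm_eq_tsum_rpow h2, lp.norm_eq_tsum_rpow h2]
        exact congrArg (fun s : ℝ => s ^ (1 / (2 : ℝ≥0∞).toReal)) h }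

/-- The operator `∑ₓ |x⟩⟨x| ⊗ A`, for a `2 × 2` matrix `A`. -/
def coinOp (A : Matrix (Fin 2) (Fin 2) ℂ) : State →L[ℂ] State :=
  lp.mapCLM 2 (fun _ : ℤ => Matrix.toEuclideanCLM (𝕜 := ℂ) A) (norm_nonneg _) (fun _ => le_rfl)

/-- The operator `∑ₓ |x + j⟩⟨x| ⊗ A`. -/
def hop (j : ℤ) (A : Matrix (Fin 2) (Fin 2) ℂ) : State →L[ℂ] State :=
  translate j ∘L coinOp A

theorem hop_apply (j : ℤ) (A : Matrix (Fin 2) (Fin 2) ℂ) (ψ : State) (x : ℤ) (i : Fin 2) :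
    (hop j A ψ) x i = A i 0 * ψ (x - j) 0 + A i 1 * ψ (x - j) 1 := by
  change (Matrix.toEuclideanCLM (𝕜 := ℂ) A (ψ (x - j))).ofLp i = _
  rw [Matrix.ofLp_toEuclideanCLM]
  simp [Matrix.mulVec, dotProduct, Fin.sum_univ_two]

/-! ### The walk -/

/-- `ρ₀ = √(1 - ρ²)`. -/
def rho0 (ρ : ℝ) : ℝ := √(1 - ρ ^ 2)

/-- `α₀ = ρ e^{iν}`. -/
def alpha0 (ρ ν : ℝ) : ℂ := ρ * Complex.exp (Complex.I * ν)

/-- The five-diagonal (CMV) operator `V`. -/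
def V (ρ ν : ℝ) : State →L[ℂ] State :=
  hop (-1) !![0, 0;
              rho0 ρ * conj (alpha0 ρ ν), (rho0 ρ : ℂ) ^ 2]
  + hop 0 !![-(1 - (rho0 ρ : ℂ) ^ 2), -(alpha0 ρ ν * rho0 ρ);
             rho0 ρ * conj (alpha0 ρ ν), -(1 - (rho0 ρ : ℂ) ^ 2)]
  + hop 1 !![(rho0 ρ : ℂ) ^ 2, -(alpha0 ρ ν * rho0 ρ);
             0, 0]

/-- The coin flip `U_f`. -/
def Uf : State →L[ℂ] State := hop 0 !![0, 1; 1, 0]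

/-- The time evolution `U = V U_f`. -/
def U (ρ ν : ℝ) : State →L[ℂ] State := V ρ ν ∘L Uf

/-- The initial state `|0⟩ ⊗ (α|0⟩ + β|1⟩)`. -/
def initial (α β : ℂ) : State := lp.single 2 (0 : ℤ) !₂[α, β]

/-- The state `Ψ_t = U^t Ψ_0` at time `t`. -/
def Psi (ρ ν : ℝ) (α β : ℂ) (t : ℕ) : State := (U ρ ν ^ t) (initial α β)

/-! ### The evolution is isometric, so that it defines probability distributions -/

theorem U_apply_zero (ρ ν : ℝ) (ψ : State) (x : ℤ) :
    (U ρ ν ψ) x 0 = -(alpha0 ρ ν * rho0 ρ) * (ψ x 0 + ψ (x - 1) 0)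
      - (1 - (rho0 ρ : ℂ) ^ 2) * ψ x 1 + (rho0 ρ : ℂ) ^ 2 * ψ (x - 1) 1 := by
  simp [U, V, Uf, hop_apply]
  ring

theorem U_apply_one (ρ ν : ℝ) (ψ : State) (x : ℤ) :
    (U ρ ν ψ) x 1 = rho0 ρ * conj (alpha0 ρ ν) * (ψ x 1 + ψ (x + 1) 1)
      - (1 - (rho0 ρ : ℂ) ^ 2) * ψ x 0 + (rho0 ρ : ℂ) ^ 2 * ψ (x + 1) 0 := by
  simp [U, V, Uf, hop_apply]
  ring

theorem hasSum_norm_sq (ψ : State) : HasSum (fun x => ‖ψ x‖ ^ 2) (‖ψ‖ ^ 2) := by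
  have h := lp.hasSum_norm (p := 2) (by norm_num) ψ
  simpa using h

theorem norm_sq_rotate (r s : ℝ) (h : r ^ 2 + s ^ 2 = 1) (a b : ℂ) :
    ‖s * a + r * b‖ ^ 2 + ‖r * a - s * b‖ ^ 2 = ‖a‖ ^ 2 + ‖b‖ ^ 2 := by
  simp only [Complex.sq_norm, Complex.normSq_apply, Complex.add_re, Complex.add_im,
    Complex.sub_re, Complex.sub_im, Complex.re_ofReal_mul, Complex.im_ofReal_mul]
  linear_combination (a.re ^ 2 + a.im ^ 2 + b.re ^ 2 + b.im ^ 2) * h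

theorem norm_U (ρ ν : ℝ) (hρ : ρ ∈ Ioo (0 : ℝ) 1) (ψ : State) : ‖U ρ ν ψ‖ = ‖ψ‖ := by
  obtain ⟨e, he⟩ : ∃ e : ℂ, e = Complex.exp (Complex.I * ν) := ⟨_, rfl⟩
  have hne : ‖e‖ = 1 := by rw [he, mul_comm, Complex.norm_exp_ofReal_mul_I]
  have hce : conj e * e = 1 := by
    rw [mul_comm, Complex.mul_conj, Complex.normSq_eq_norm_sq, hne]; simp
  have hα : alpha0 ρ ν = ρ * e := by rw [he]; rfl
  obtain ⟨s, hs⟩ : ∃ s, s = rho0 ρ := ⟨_, rfl⟩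
  have hrs : ρ ^ 2 + s ^ 2 = 1 := by
    rw [hs, rho0, Real.sq_sqrt (by nlinarith [hρ.1, hρ.2])]; ring
  have hrsC : (ρ : ℂ) ^ 2 + (s : ℂ) ^ 2 = 1 := by exact_mod_cast hrs
  -- the intermediate amplitudes of the factorised evolution
  let u : ℤ → ℂ := fun x => s * ψ x 1 + ρ * (-e * ψ x 0)
  let w : ℤ → ℂ := fun x => -(ρ * ψ x 1 - s * (-e * ψ x 0))
  let P : ℤ → ℂ := fun x => s * u (x - 1) + ρ * w x
  let Q : ℤ → ℂ := fun x => ρ * u (x - 1) - s * w x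
  have h0 : ∀ x, (U ρ ν ψ) x 0 = P x := fun x => by
    rw [U_apply_zero, hα, ← hs]
    simp only [P, u, w]
    linear_combination (ψ x 1) * hrsC
  have h1 : ∀ x, (U ρ ν ψ) x 1 = conj e * Q (x + 1) := fun x => by
    rw [U_apply_one, hα, ← hs]
    simp only [Q, u, w, map_mul, Complex.conj_ofReal, add_sub_cancel_right]
    linear_combination (ψ x 0) * hrsC + ((ρ : ℂ) ^ 2 * ψ x 0 - (s : ℂ) ^ 2 * ψ (x + 1) 0) * hce
  have hnorm : ∀ (φ : State) x, ‖φ x‖ ^ 2 = ‖φ x 0‖ ^ 2 + ‖φ x 1‖ ^ 2 := fun φ x => by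
    rw [EuclideanSpace.norm_sq_eq, Fin.sum_univ_two]
  have huw : ∀ x, ‖u x‖ ^ 2 + ‖w x‖ ^ 2 = ‖ψ x‖ ^ 2 := fun x => by
    simp only [u, w]
    rw [norm_neg, norm_sq_rotate ρ s hrs, norm_mul, norm_neg, hne, hnorm]
    ring
  have hPQ : ∀ x, ‖P x‖ ^ 2 + ‖Q x‖ ^ 2 = ‖u (x - 1)‖ ^ 2 + ‖w x‖ ^ 2 := fun x =>
    norm_sq_rotate ρ s hrs _ _
  have hU : ∀ x, ‖(U ρ ν ψ) x‖ ^ 2 = ‖P x‖ ^ 2 + ‖Q (x + 1)‖ ^ 2 := fun x => by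
    rw [hnorm, h0, h1, norm_mul, RCLike.norm_conj, hne, one_mul]
  have hψs := (hasSum_norm_sq ψ).summable
  have hUs := (hasSum_norm_sq (U ρ ν ψ)).summable
  have hus : Summable fun x => ‖u x‖ ^ 2 :=
    hψs.of_nonneg_of_le (fun x => sq_nonneg _) fun x => by rw [← huw]; linarith [sq_nonneg ‖w x‖]
  have hws : Summable fun x => ‖w x‖ ^ 2 :=
    hψs.of_nonneg_of_le (fun x => sq_nonneg _) fun x => by rw [← huw]; linarith [sq_nonneg ‖u x‖]
  have hPs : Summable fun x => ‖P x‖ ^ 2 :=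
    hUs.of_nonneg_of_le (fun x => sq_nonneg _) fun x => by
      rw [hU]; linarith [sq_nonneg ‖Q (x + 1)‖]
  have hQs' : Summable fun x => ‖Q (x + 1)‖ ^ 2 :=
    hUs.of_nonneg_of_le (fun x => sq_nonneg _) fun x => by rw [hU]; linarith [sq_nonneg ‖P x‖]
  have hQs : Summable fun x => ‖Q x‖ ^ 2 := (Equiv.addRight (1 : ℤ)).summable_iff.mp hQs'
  have hus' : Summable fun x => ‖u (x - 1)‖ ^ 2 := (Equiv.subRight (1 : ℤ)).summable_iff.mpr hus
  have key : ‖U ρ ν ψ‖ ^ 2 = ‖ψ‖ ^ 2 := by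
    rw [← (hasSum_norm_sq (U ρ ν ψ)).tsum_eq, ← (hasSum_norm_sq ψ).tsum_eq]
    calc ∑' x, ‖(U ρ ν ψ) x‖ ^ 2
        = ∑' x, (‖P x‖ ^ 2 + ‖Q (x + 1)‖ ^ 2) := tsum_congr hU
      _ = ∑' x, ‖P x‖ ^ 2 + ∑' x, ‖Q (x + 1)‖ ^ 2 := hPs.tsum_add hQs'
      _ = ∑' x, ‖P x‖ ^ 2 + ∑' x, ‖Q x‖ ^ 2 := by
        rw [(Equiv.addRight (1 : ℤ)).tsum_eq (fun x => ‖Q x‖ ^ 2) |>.symm]; rfl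
      _ = ∑' x, (‖u (x - 1)‖ ^ 2 + ‖w x‖ ^ 2) := by
        rw [← hPs.tsum_add hQs]; exact tsum_congr hPQ
      _ = ∑' x, ‖u x‖ ^ 2 + ∑' x, ‖w x‖ ^ 2 := by
        rw [hus'.tsum_add hws, (Equiv.subRight (1 : ℤ)).tsum_eq (fun x => ‖u x‖ ^ 2) |>.symm]; rfl
      _ = ∑' x, ‖ψ x‖ ^ 2 := by
        rw [← hus.tsum_add hws]; exact tsum_congr huw
  exact (sq_eq_sq₀ (norm_nonneg _) (norm_nonneg _)).mp key

theorem norm_Psi (ρ ν : ℝ) (hρ : ρ ∈ Ioo (0 : ℝ) 1) (α β : ℂ) (h : ‖α‖ ^ 2 + ‖β‖ ^ 2 = 1) (t : ℕ) :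
    ‖Psi ρ ν α β t‖ = 1 := by
  induction t with
  | zero =>
    rw [Psi, pow_zero, one_apply_eq_self, initial, lp.norm_single (by norm_num),
      EuclideanSpace.norm_eq, Fin.sum_univ_two]
    simp [h]
  | succ t ih =>
    rw [Psi, pow_succ', mul_apply_eq_comp, norm_U ρ ν hρ]
    exact ih

/-- The law of the position `X_t`, that is, the probability measure on `ℤ` with
`ℙ(X_t = x) = ‖Ψ_t(x)‖²`. -/
def law (ρ ν : ℝ) (hρ : ρ ∈ Ioo (0 : ℝ) 1) (α β : ℂ) (h : ‖α‖ ^ 2 + ‖β‖ ^ 2 = 1) (t : ℕ) :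
    ProbabilityMeasure ℤ :=
  ⟨Measure.sum fun x : ℤ => ENNReal.ofReal (‖Psi ρ ν α β t x‖ ^ 2) • Measure.dirac x, ⟨by
    have hs := hasSum_norm_sq (Psi ρ ν α β t)
    rw [Measure.sum_apply _ MeasurableSet.univ]
    simp only [Measure.smul_apply, measure_univ, smul_eq_mul, mul_one]
    rw [← ENNReal.ofReal_tsum_of_nonneg (fun _ => sq_nonneg _) hs.summable, hs.tsum_eq,
      norm_Psi ρ ν hρ α β h]
    simp⟩⟩

/-! ### The limit density -/

/-- The function `ξ`. -/
def xi (ρ ν x : ℝ) : ℝ :=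
  (ρ ^ 2 - x ^ 2) * (rho0 ρ ^ 2 - x ^ 2) - ρ ^ 2 * rho0 ρ ^ 2 * Real.cos ν ^ 2 * x ^ 2

/-- The function `η₊`. -/
def etaPlus (ρ ν x : ℝ) : ℝ :=
  1 - ρ ^ 2 * rho0 ρ ^ 2 * (1 + Real.sin ν ^ 2) - (1 - ρ ^ 2 * rho0 ρ ^ 2 * Real.cos ν ^ 2) * x ^ 2
    + 2 * ρ * rho0 ρ * Real.sin ν * √(xi ρ ν x)

/-- The function `η₋`. -/
def etaMinus (ρ ν x : ℝ) : ℝ :=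
  1 - ρ ^ 2 * rho0 ρ ^ 2 * (1 + Real.sin ν ^ 2) - (1 - ρ ^ 2 * rho0 ρ ^ 2 * Real.cos ν ^ 2) * x ^ 2
    - 2 * ρ * rho0 ρ * Real.sin ν * √(xi ρ ν x)

/-- The function `γ`. -/
def gam (ρ ν : ℝ) (α β : ℂ) (x : ℝ) : ℝ :=
  1 + (‖α‖ ^ 2 - ‖β‖ ^ 2
    - 2 * rho0 ρ / ρ * ((α * conj β).re * Real.cos ν - (α * conj β).im * Real.sin ν)) * x

/-- The edge `h*` of the support. -/
def hstar (ρ ν : ℝ) : ℝ :=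
  1 / 2 * (√((1 + ρ * rho0 ρ) ^ 2 - ρ ^ 2 * rho0 ρ ^ 2 * Real.sin ν ^ 2)
    - √((1 - ρ * rho0 ρ) ^ 2 - ρ ^ 2 * rho0 ρ ^ 2 * Real.sin ν ^ 2))

/-- The limit density: the explicit function on `(-h*, h*)`, and zero elsewhere. -/
def density (ρ ν : ℝ) (α β : ℂ) : ℝ → ℝ :=
  (Ioo (-hstar ρ ν) (hstar ρ ν)).indicator fun y =>
    (√(etaPlus ρ ν y) + √(etaMinus ρ ν y)) / (2 * Real.pi * (1 - y ^ 2) * √(xi ρ ν y))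
      * gam ρ ν α β y

/-- The measure on `ℝ` with the limit density. -/
def limitLaw (ρ ν : ℝ) (α β : ℂ) : Measure ℝ :=
  volume.withDensity fun y => ENNReal.ofReal (density ρ ν α β y)

end QWalk
end

namespace QWalk

/-! ### The group velocity -/

/-! The walk is translation invariant, so Fourier transform turns `U` into multiplication by a 2×2
matrix. Put c = ρρ₀, σ = sin ν and momentum k = ν - q. The matrix is then i(cos θ + i sin θ N) with
cos θ = -c(σ + sin q) and N = N(q) a Hermitian involution (`symbol_eq`, `refl_mul_self`). The
excluded parameters are exactly those with c(1 + |σ|) = 1, where sin θ vanishes somewhere and N and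
θ′ degenerate.

By Parseval (`charFun_law`), the characteristic function of X_t/t at u is the average over k of the
overlap of the evolved initial vector φ at momenta k and k - u/t. De Moivre's formula makes the
overlap depend on t(θ(q + u/t) - θ(q)), up to terms that vanish because N is continuous
(`overlap_eq`). With v = θ′ the group velocity and n(q) = ⟨φ, N(q)φ⟩, it tends to cos(uv) + i n
sin(uv), and dominated convergence gives the limit of the averages.

The reflection q ↦ π - q turns v into -v, so only the part of n that is odd under it contributes;
that part is γ(v) - 1 (`reflMean_sub_reflMean`). The limit is therefore the average of γ(v)e^{iuv}:
the limit law is the image of γ(v(q)) dq/2π under v. Since |n| ≤ 1, the same identity gives γ ≥ 0 on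
the range of v.

It remains to compute this image. The derivative of v changes sign exactly twice on the circle, so v
maps two complementary arcs bijectively onto (-h*, h*) (`exists_arcs`). Along them ξ(v) is the
square of a rational function of sin q, and η₊ or η₋, according to the arc, equals (1 - v²)² sin² θ.
Each half of the density is thus the inverse Jacobian 1/(2π|v′|) of one arc
(`abs_deriv_mul_branch`). Convergence in distribution follows from Lévy's continuity theorem, and
convergence of the distribution functions from the absence of atoms. -/

/-- The parameter range in which the dispersion relation `cos θ = -c (σ + sin q)` is
nondegenerate. -/
structure Admissible (c σ : ℝ) : Prop where
  pos : 0 < c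
  add : c * (1 + σ) < 1
  sub : c * (1 - σ) < 1
  sq_le : σ ^ 2 ≤ 1

/-- `sin² θ` for the dispersion relation `cos θ = -c (σ + sin q)`. -/
noncomputable def sinSq (c σ q : ℝ) : ℝ := 1 - c ^ 2 * (σ + Real.sin q) ^ 2

/-- The group velocity of the dispersion relation `cos θ = -c (σ + sin q)`. -/
noncomputable def vel (c σ q : ℝ) : ℝ := c * Real.cos q / √(sinSq c σ q)

/-- The numerator of the derivative of the group velocity as a function of `sin q`. -/
def critPoly (c σ s : ℝ) : ℝ := -s + c ^ 2 * (σ + s) * (1 + s * σ)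

/-- The quartic `ξ` in terms of `c = ρ ρ₀` and `σ = sin ν`. -/
def quartic (c σ y : ℝ) : ℝ := y ^ 4 - (1 + c ^ 2 * (1 - σ ^ 2)) * y ^ 2 + c ^ 2

/-- The part of `η₊` and `η₋` without square roots. -/
def etaBase (c σ y : ℝ) : ℝ := 1 - c ^ 2 * (1 + σ ^ 2) - (1 - c ^ 2 * (1 - σ ^ 2)) * y ^ 2

theorem abs_dispersion_lt_one {c σ : ℝ} (H : Admissible c σ) (q : ℝ) :
    |c * (σ + Real.sin q)| < 1 := by
  have h1 := Real.neg_one_le_sin q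
  have h2 := Real.sin_le_one q
  have := H.pos; have := H.add; have := H.sub
  rw [abs_lt]
  constructor <;> nlinarith

theorem sinSq_pos {c σ : ℝ} (H : Admissible c σ) (q : ℝ) : 0 < sinSq c σ q := by
  have h := (sq_lt_one_iff_abs_lt_one _).mpr (abs_dispersion_lt_one H q)
  unfold sinSq
  nlinarith

theorem Admissible.lt_one {c σ : ℝ} (H : Admissible c σ) : c < 1 := by
  linarith [H.add, H.sub]

theorem continuous_sinSq (c σ : ℝ) : Continuous (sinSq c σ) := by
  unfold sinSq; fun_prop

theorem continuous_vel {c σ : ℝ} (H : Admissible c σ) : Continuous (vel c σ) := by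
  unfold vel
  exact (by fun_prop : Continuous fun q => c * Real.cos q).div
    (continuous_sinSq c σ).sqrt fun q => (Real.sqrt_pos.mpr (sinSq_pos H q)).ne'

theorem vel_sq {c σ : ℝ} (H : Admissible c σ) (q : ℝ) :
    vel c σ q ^ 2 = c ^ 2 * (1 - Real.sin q ^ 2) / sinSq c σ q := by
  rw [vel, div_pow, Real.sq_sqrt (sinSq_pos H q).le, mul_pow, Real.cos_sq']

theorem hasDerivAt_vel {c σ : ℝ} (H : Admissible c σ) (q : ℝ) :
    HasDerivAt (vel c σ)
      (c * critPoly c σ (Real.sin q) / (sinSq c σ q * √(sinSq c σ q))) q := by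
  have hD := sinSq_pos H q
  have hsD : HasDerivAt (sinSq c σ) (-(c ^ 2 * (2 * (σ + Real.sin q) * Real.cos q))) q := by
    have := (((Real.hasDerivAt_sin q).const_add σ).pow 2).const_mul (c ^ 2) |>.const_sub 1
    convert! this using 1
    simp
  have h := ((Real.hasDerivAt_cos q).const_mul c).div (hsD.sqrt hD.ne')
    (Real.sqrt_pos.mpr hD).ne'
  convert! h using 1
  have hs : √(sinSq c σ q) ≠ 0 := (Real.sqrt_pos.mpr hD).ne'
  have h2 := Real.sq_sqrt hD.le
  set r := √(sinSq c σ q)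
  rw [← h2]
  field_simp
  rw [h2, critPoly, sinSq]
  linear_combination (-c ^ 3 * (σ + Real.sin q)) * Real.sin_sq_add_cos_sq q

theorem quartic_vel {c σ : ℝ} (H : Admissible c σ) (q : ℝ) :
    quartic c σ (vel c σ q) = (c * critPoly c σ (Real.sin q) / sinSq c σ q) ^ 2 := by
  have hD := (sinSq_pos H q).ne'
  rw [quartic, show vel c σ q ^ 4 = (vel c σ q ^ 2) ^ 2 by ring, vel_sq H]
  field_simp
  rw [critPoly, sinSq]
  ring

/-- The signed root of ξ(v) from `quartic_vel` stands in place of √ξ, so the sign of `critPoly`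
decides whether this describes η₊ or η₋. -/
theorem etaBase_vel {c σ : ℝ} (H : Admissible c σ) (q : ℝ) :
    etaBase c σ (vel c σ q) + 2 * c * σ * (c * critPoly c σ (Real.sin q) / sinSq c σ q)
      = (1 - vel c σ q ^ 2) ^ 2 * sinSq c σ q := by
  have hD := (sinSq_pos H q).ne'
  rw [etaBase, vel_sq H]
  field_simp
  rw [critPoly, sinSq]
  ring

/-- In y², the quartic has roots with product c², one on each side of c. This bound keeps v² below
the larger root, so at a critical point v² must be the smaller one. -/
theorem vel_sq_lt {c σ : ℝ} (H : Admissible c σ) (q : ℝ) : vel c σ q ^ 2 < c := by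
  have hD := sinSq_pos H q
  rw [vel_sq H, div_lt_iff₀ hD]
  have hc := H.pos
  have hc1 := H.lt_one
  have key : 0 < sinSq c σ q - c * (1 - Real.sin q ^ 2) := by
    have h1 : c ^ 2 * σ ^ 2 < (1 - c) ^ 2 := by
      nlinarith [mul_pos (sub_pos.mpr H.add) (sub_pos.mpr H.sub)]
    -- Completing the square in s = sin q turns the product into c((1 - c)s - cσ)² + (1 - c)² -
    -- c²σ².
    have h2 : 0 < (1 - c) * (sinSq c σ q - c * (1 - Real.sin q ^ 2)) := by
      rw [sinSq]
      nlinarith [mul_nonneg hc.le (sq_nonneg ((1 - c) * Real.sin q - c * σ))]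
    exact pos_of_mul_pos_right h2 (by linarith)
  nlinarith

theorem one_sub_vel_sq_pos {c σ : ℝ} (H : Admissible c σ) (q : ℝ) : 0 < 1 - vel c σ q ^ 2 := by
  linarith [vel_sq_lt H q, H.lt_one]

theorem vel_add_two_pi (c σ q : ℝ) : vel c σ (q + 2 * Real.pi) = vel c σ q := by
  simp [vel, sinSq]

theorem vel_pi_sub (c σ q : ℝ) : vel c σ (Real.pi - q) = -vel c σ q := by
  simp [vel, sinSq, neg_div]

/-! ### The arcs on which the group velocity is monotone -/

/-- The endpoint values -1 + c²(1 + σ)² and 1 - c²(1 - σ)² have opposite signs, which gives a root.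
Dividing it out leaves an affine cofactor, negative at both ends and hence on the whole interval. -/
theorem exists_critPoly_sign {c σ : ℝ} (H : Admissible c σ) :
    ∃ s₀ ∈ Ioo (-1 : ℝ) 1, critPoly c σ s₀ = 0 ∧
      (∀ s ∈ Icc (-1 : ℝ) 1, s < s₀ → 0 < critPoly c σ s) ∧
      ∀ s ∈ Icc (-1 : ℝ) 1, s₀ < s → critPoly c σ s < 0 := by
  have hc := H.pos
  have hadd : (c * (1 + σ)) ^ 2 < 1 := by
    have := H.add; have := H.sub; have := H.lt_one
    rw [sq_lt_one_iff_abs_lt_one, abs_lt]; constructor <;> nlinarith [H.sq_le]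
  have hsub : (c * (1 - σ)) ^ 2 < 1 := by
    have := H.add; have := H.sub; have := H.lt_one
    rw [sq_lt_one_iff_abs_lt_one, abs_lt]; constructor <;> nlinarith [H.sq_le]
  have hp1 : critPoly c σ 1 < 0 := by unfold critPoly; nlinarith
  have hm1 : 0 < critPoly c σ (-1) := by unfold critPoly; nlinarith
  have hcont : ContinuousOn (critPoly c σ) (Icc (-1) 1) := by unfold critPoly; fun_prop
  obtain ⟨s₀, hs₀, h0⟩ := intermediate_value_Ioo' (by norm_num) hcont ⟨hp1, hm1⟩
  have hfac : ∀ s, critPoly c σ s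
      = (s - s₀) * (c ^ 2 * σ * (s + s₀) - (1 - c ^ 2 - c ^ 2 * σ ^ 2)) := fun s => by
    have : critPoly c σ s = critPoly c σ s - critPoly c σ s₀ := by rw [h0, sub_zero]
    rw [this]; unfold critPoly; ring
  have hL1 : c ^ 2 * σ * (1 + s₀) - (1 - c ^ 2 - c ^ 2 * σ ^ 2) < 0 := by
    rw [hfac] at hp1
    by_contra h
    push Not at h
    nlinarith [mul_nonneg (sub_nonneg.mpr hs₀.2.le) h]
  have hL2 : c ^ 2 * σ * (-1 + s₀) - (1 - c ^ 2 - c ^ 2 * σ ^ 2) < 0 := by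
    rw [hfac] at hm1
    by_contra h
    push Not at h
    nlinarith [mul_nonneg (by linarith [hs₀.1] : (0 : ℝ) ≤ 1 + s₀) h]
  have hL : ∀ s ∈ Icc (-1 : ℝ) 1,
      c ^ 2 * σ * (s + s₀) - (1 - c ^ 2 - c ^ 2 * σ ^ 2) < 0 := fun s hs => by
    rcases le_total 0 (c ^ 2 * σ) with h | h
    · nlinarith [mul_nonneg h (sub_nonneg.mpr hs.2)]
    · nlinarith [mul_nonneg (neg_nonneg.mpr h) (by linarith [hs.1] : (0 : ℝ) ≤ 1 + s)]
  refine ⟨s₀, hs₀, h0, fun s hs hlt => ?_, fun s hs hlt => ?_⟩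
  · rw [hfac]; exact mul_pos_of_neg_of_neg (by linarith) (hL s hs)
  · rw [hfac]; exact mul_neg_of_pos_of_neg (by linarith) (hL s hs)

theorem sin_lt_sin_of_mem_arc {a q : ℝ} (ha : a ∈ Ioo (-(Real.pi / 2)) (Real.pi / 2))
    (hq : q ∈ Ioo a (Real.pi - a)) : Real.sin a < Real.sin q := by
  rcases le_total q (Real.pi / 2) with h | h
  · exact Real.sin_lt_sin_of_lt_of_le_pi_div_two ha.1.le h hq.1
  · rw [← Real.sin_pi_sub q]
    exact Real.sin_lt_sin_of_lt_of_le_pi_div_two ha.1.le (by linarith) (by linarith [hq.2])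

theorem sin_lt_sin_of_mem_compl_arc {a q : ℝ} (ha : a ∈ Ioo (-(Real.pi / 2)) (Real.pi / 2))
    (hq : q ∈ Ioo (Real.pi - a) (2 * Real.pi + a)) : Real.sin q < Real.sin a := by
  have h := sin_lt_sin_of_mem_arc (a := -a) (q := q - Real.pi)
    ⟨by linarith [ha.2], by linarith [ha.1]⟩ ⟨by linarith [hq.1], by linarith [hq.2]⟩
  rw [Real.sin_neg, Real.sin_sub_pi] at h
  linarith

/-- `h` is the smaller positive root of the quartic. -/
structure IsEdge (c σ h : ℝ) : Prop where
  pos : 0 < h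
  sq_lt : h ^ 2 < c
  root : quartic c σ h = 0

/-- Factorisation over the roots h² and c²/h² in y², multiplied by h² to avoid division. -/
theorem quartic_mul_sq {c σ h : ℝ} (E : IsEdge c σ h) (y : ℝ) :
    quartic c σ y * h ^ 2 = (h ^ 2 - y ^ 2) * (c ^ 2 - h ^ 2 * y ^ 2) := by
  have := E.root
  unfold quartic at *
  linear_combination y ^ 2 * this

theorem sq_mul_sq_lt {c σ h y : ℝ} (E : IsEdge c σ h) (hy : y ^ 2 < c) :
    0 < c ^ 2 - h ^ 2 * y ^ 2 := by
  nlinarith [E.sq_lt, E.pos, sq_nonneg y, sq_nonneg h]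

theorem quartic_pos {c σ h y : ℝ} (E : IsEdge c σ h) (hy : y ∈ Ioo (-h) h) :
    0 < quartic c σ y := by
  have h1 : y ^ 2 < h ^ 2 := sq_lt_sq' hy.1 hy.2
  have h2 := mul_pos (sub_pos.mpr h1) (sq_mul_sq_lt E (h1.trans E.sq_lt))
  rw [← quartic_mul_sq E] at h2
  exact pos_of_mul_pos_left h2 (sq_nonneg h)

theorem vel_eq_edge {c σ h q : ℝ} (H : Admissible c σ) (E : IsEdge c σ h)
    (hq : critPoly c σ (Real.sin q) = 0) (hcos : 0 ≤ Real.cos q) : vel c σ q = h := by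
  have h1 := quartic_mul_sq E (vel c σ q)
  rw [quartic_vel H, hq] at h1
  have h2 := sq_mul_sq_lt E (vel_sq_lt H q)
  have h3 : h ^ 2 - vel c σ q ^ 2 = 0 := by
    rcases mul_eq_zero.mp (h1.symm.trans (by simp)) with h | h
    · exact h
    · exact absurd h h2.ne'
  have h4 : 0 ≤ vel c σ q := div_nonneg (mul_nonneg H.pos.le hcos) (Real.sqrt_nonneg _)
  exact (sq_eq_sq₀ h4 E.pos.le).mp (by linarith)

theorem image_Ioo_of_strictAntiOn {f : ℝ → ℝ} {a b : ℝ} (hab : a ≤ b)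
    (hf : StrictAntiOn f (Icc a b)) (hc : ContinuousOn f (Icc a b)) :
    f '' Ioo a b = Ioo (f b) (f a) := by
  refine Subset.antisymm ?_ (intermediate_value_Ioo' hab hc)
  rintro _ ⟨x, hx, rfl⟩
  exact ⟨hf (Ioo_subset_Icc_self hx) ⟨hab, le_rfl⟩ hx.2,
    hf ⟨le_rfl, hab⟩ (Ioo_subset_Icc_self hx) hx.1⟩

theorem image_Ioo_of_strictMonoOn {f : ℝ → ℝ} {a b : ℝ} (hab : a ≤ b)
    (hf : StrictMonoOn f (Icc a b)) (hc : ContinuousOn f (Icc a b)) :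
    f '' Ioo a b = Ioo (f a) (f b) := by
  refine Subset.antisymm ?_ (intermediate_value_Ioo hab hc)
  rintro _ ⟨x, hx, rfl⟩
  exact ⟨hf ⟨le_rfl, hab⟩ (Ioo_subset_Icc_self hx) hx.1,
    hf (Ioo_subset_Icc_self hx) ⟨hab, le_rfl⟩ hx.2⟩

/-- The circle splits into two arcs, each of which the group velocity maps bijectively onto
`(-h, h)`. -/
theorem exists_arcs {c σ h : ℝ} (H : Admissible c σ) (E : IsEdge c σ h) :
    ∃ a ∈ Ioo (-(Real.pi / 2)) (Real.pi / 2),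
      ((∀ q ∈ Ioo a (Real.pi - a), critPoly c σ (Real.sin q) < 0) ∧
        InjOn (vel c σ) (Ioo a (Real.pi - a)) ∧
        vel c σ '' Ioo a (Real.pi - a) = Ioo (-h) h) ∧
      (∀ q ∈ Ioo (Real.pi - a) (2 * Real.pi + a), 0 < critPoly c σ (Real.sin q)) ∧
        InjOn (vel c σ) (Ioo (Real.pi - a) (2 * Real.pi + a)) ∧
        vel c σ '' Ioo (Real.pi - a) (2 * Real.pi + a) = Ioo (-h) h := by
  obtain ⟨s₀, hs₀, h0, hpos, hneg⟩ := exists_critPoly_sign H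
  have hsin : Real.sin (Real.arcsin s₀) = s₀ := Real.sin_arcsin hs₀.1.le hs₀.2.le
  have ha : Real.arcsin s₀ ∈ Ioo (-(Real.pi / 2)) (Real.pi / 2) :=
    ⟨Real.neg_pi_div_two_lt_arcsin.mpr hs₀.1, Real.arcsin_lt_pi_div_two.mpr hs₀.2⟩
  set a := Real.arcsin s₀
  have hmem : ∀ q, Real.sin q ∈ Icc (-1 : ℝ) 1 := fun q =>
    ⟨Real.neg_one_le_sin q, Real.sin_le_one q⟩
  have h1 : ∀ q ∈ Ioo a (Real.pi - a), critPoly c σ (Real.sin q) < 0 := fun q hq =>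
    hneg _ (hmem q) (hsin ▸ sin_lt_sin_of_mem_arc ha hq)
  have h2 : ∀ q ∈ Ioo (Real.pi - a) (2 * Real.pi + a), 0 < critPoly c σ (Real.sin q) :=
    fun q hq => hpos _ (hmem q) (hsin ▸ sin_lt_sin_of_mem_compl_arc ha hq)
  -- The arcs meet at the critical points a and π - a of the velocity, where it takes its extreme
  -- values ±h.
  have hva : vel c σ a = h :=
    vel_eq_edge H E (by rw [hsin, h0]) (Real.cos_pos_of_mem_Ioo ha).le
  have hvb : vel c σ (Real.pi - a) = -h := by rw [vel_pi_sub, hva]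
  have hvc : vel c σ (2 * Real.pi + a) = h := by rw [add_comm, vel_add_two_pi, hva]
  have hden : ∀ q, 0 < sinSq c σ q * √(sinSq c σ q) := fun q =>
    mul_pos (sinSq_pos H q) (Real.sqrt_pos.mpr (sinSq_pos H q))
  have hanti : StrictAntiOn (vel c σ) (Icc a (Real.pi - a)) := by
    refine strictAntiOn_of_deriv_neg (convex_Icc _ _) (continuous_vel H).continuousOn ?_
    intro q hq
    rw [interior_Icc] at hq
    rw [(hasDerivAt_vel H q).deriv]
    exact div_neg_of_neg_of_pos (mul_neg_of_pos_of_neg H.pos (h1 q hq)) (hden q)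
  have hmono : StrictMonoOn (vel c σ) (Icc (Real.pi - a) (2 * Real.pi + a)) := by
    refine strictMonoOn_of_deriv_pos (convex_Icc _ _) (continuous_vel H).continuousOn ?_
    intro q hq
    rw [interior_Icc] at hq
    rw [(hasDerivAt_vel H q).deriv]
    exact div_pos (mul_pos H.pos (h2 q hq)) (hden q)
  refine ⟨a, ha, ⟨h1, hanti.injOn.mono Ioo_subset_Icc_self, ?_⟩, h2,
    hmono.injOn.mono Ioo_subset_Icc_self, ?_⟩
  · rw [image_Ioo_of_strictAntiOn (by linarith [ha.2]) hanti (continuous_vel H).continuousOn,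
      hva, hvb]
  · rw [image_Ioo_of_strictMonoOn (by linarith [ha.1]) hmono (continuous_vel H).continuousOn,
      hvc, hvb]

/-! ### Change of variables along the arcs -/

/-- The contribution to the limit density of the arc on which `critPoly` has the sign `ε`. -/
noncomputable def branch (c σ ε y : ℝ) : ℝ :=
  √(etaBase c σ y + ε * (2 * c * σ * √(quartic c σ y)))
    / (2 * Real.pi * (1 - y ^ 2) * √(quartic c σ y))

theorem sqrt_quartic_vel {c σ ε q : ℝ} (H : Admissible c σ) (hε : ε ^ 2 = 1)
    (hp : 0 < ε * critPoly c σ (Real.sin q)) :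
    √(quartic c σ (vel c σ q)) = ε * (c * critPoly c σ (Real.sin q) / sinSq c σ q) := by
  rw [quartic_vel H]
  have h : 0 ≤ ε * (c * critPoly c σ (Real.sin q) / sinSq c σ q) := by
    rw [show ε * (c * critPoly c σ (Real.sin q) / sinSq c σ q)
      = c * (ε * critPoly c σ (Real.sin q)) / sinSq c σ q by ring]
    exact div_nonneg (mul_nonneg H.pos.le hp.le) (sinSq_pos H q).le
  rw [← Real.sqrt_sq h, mul_pow, hε, one_mul]

theorem eta_vel {c σ ε q : ℝ} (H : Admissible c σ) (hε : ε ^ 2 = 1)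
    (hp : 0 < ε * critPoly c σ (Real.sin q)) :
    etaBase c σ (vel c σ q) + ε * (2 * c * σ * √(quartic c σ (vel c σ q)))
      = (1 - vel c σ q ^ 2) ^ 2 * sinSq c σ q := by
  rw [sqrt_quartic_vel H hε hp, ← etaBase_vel H]
  linear_combination (2 * c * σ * (c * critPoly c σ (Real.sin q) / sinSq c σ q)) * hε

/-- Along the arc √η = (1 - v²)√D and √ξ = c|p|/D with D = `sinSq` and p = `critPoly`, while |v′| =
c|p|/D^{3/2}; everything cancels except 1/(2π). -/
theorem abs_deriv_mul_branch {c σ ε q : ℝ} (H : Admissible c σ) (hε : ε ^ 2 = 1)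
    (hp : 0 < ε * critPoly c σ (Real.sin q)) :
    |c * critPoly c σ (Real.sin q) / (sinSq c σ q * √(sinSq c σ q))| * branch c σ ε (vel c σ q)
      = 1 / (2 * Real.pi) := by
  have hD := sinSq_pos H q
  have hV := one_sub_vel_sq_pos H q
  have hc := H.pos
  have hd : |c * critPoly c σ (Real.sin q) / (sinSq c σ q * √(sinSq c σ q))|
      = c * (ε * critPoly c σ (Real.sin q)) / (sinSq c σ q * √(sinSq c σ q)) := by
    have hεa : |ε| = 1 := by
      rw [← Real.sqrt_sq_eq_abs, hε, Real.sqrt_one]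
    rw [← one_mul |_|, ← hεa, ← abs_mul, abs_of_pos]
    · ring
    · rw [show ε * (c * critPoly c σ (Real.sin q) / (sinSq c σ q * √(sinSq c σ q)))
        = c * (ε * critPoly c σ (Real.sin q)) / (sinSq c σ q * √(sinSq c σ q)) by ring]
      exact div_pos (mul_pos hc hp) (mul_pos hD (Real.sqrt_pos.mpr hD))
  rw [hd, branch, eta_vel H hε hp, sqrt_quartic_vel H hε hp, Real.sqrt_mul (sq_nonneg _),
    Real.sqrt_sq hV.le]
  have hs := Real.sqrt_pos.mpr hD
  have hp' := hp.ne'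
  have hε0 : ε ≠ 0 := left_ne_zero_of_mul hp'
  have hp0 := right_ne_zero_of_mul hp'
  field_simp

/-- Integrability is obtained by pulling back to the arc, where the Jacobian absorbs the branch and
only a continuous function on a bounded interval remains. -/
theorem integral_branch_mul {c σ ε h a b : ℝ} (H : Admissible c σ) (hε : ε ^ 2 = 1)
    (hp : ∀ q ∈ Ioo a b, 0 < ε * critPoly c σ (Real.sin q))
    (hinj : InjOn (vel c σ) (Ioo a b)) (him : vel c σ '' Ioo a b = Ioo (-h) h)
    {G : ℝ → ℂ} (hG : Continuous G) :
    IntegrableOn (fun y => (branch c σ ε y : ℂ) * G y) (Ioo (-h) h) ∧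
      ∫ y in Ioo (-h) h, (branch c σ ε y : ℂ) * G y
        = 1 / (2 * Real.pi) * ∫ q in Ioo a b, G (vel c σ q) := by
  have hderiv : ∀ q ∈ Ioo a b, HasDerivWithinAt (vel c σ)
      (c * critPoly c σ (Real.sin q) / (sinSq c σ q * √(sinSq c σ q))) (Ioo a b) q :=
    fun q _ => (hasDerivAt_vel H q).hasDerivWithinAt
  have heq : ∀ q ∈ Ioo a b,
      |c * critPoly c σ (Real.sin q) / (sinSq c σ q * √(sinSq c σ q))|
        • ((branch c σ ε (vel c σ q) : ℂ) * G (vel c σ q))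
      = (1 / (2 * Real.pi) : ℂ) * G (vel c σ q) := fun q hq => by
    rw [Complex.real_smul, ← mul_assoc, ← Complex.ofReal_mul,
      abs_deriv_mul_branch H hε (hp q hq)]
    push_cast
    rfl
  constructor
  · rw [← him, integrableOn_image_iff_integrableOn_abs_deriv_smul measurableSet_Ioo hderiv hinj,
      integrableOn_congr_fun heq measurableSet_Ioo]
    refine IntegrableOn.mono_set ?_ Ioo_subset_Icc_self
    exact (continuous_const.mul (hG.comp (continuous_vel H))).continuousOn.integrableOn_Icc
  · rw [← him, integral_image_eq_integral_abs_deriv_smul measurableSet_Ioo hderiv hinj,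
      setIntegral_congr_fun measurableSet_Ioo heq, integral_const_mul]

theorem integral_branches_mul {c σ h : ℝ} (H : Admissible c σ) (E : IsEdge c σ h)
    {G : ℝ → ℂ} (hG : Continuous G) :
    IntegrableOn (fun y => ((branch c σ 1 y + branch c σ (-1) y : ℝ) : ℂ) * G y) (Ioo (-h) h) ∧
      ∫ y in Ioo (-h) h, ((branch c σ 1 y + branch c σ (-1) y : ℝ) : ℂ) * G y
        = 1 / (2 * Real.pi) * ∫ q in -Real.pi..Real.pi, G (vel c σ q) := by
  obtain ⟨a, ha, ⟨hn, hi1, hm1⟩, hp, hi2, hm2⟩ := exists_arcs H E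
  obtain ⟨i1, e1⟩ := integral_branch_mul (ε := -1) H (by norm_num)
    (fun q hq => by linarith [hn q hq]) hi1 hm1 hG
  obtain ⟨i2, e2⟩ := integral_branch_mul (ε := 1) H (by norm_num)
    (fun q hq => by linarith [hp q hq]) hi2 hm2 hG
  have hsplit : ∀ y, ((branch c σ 1 y + branch c σ (-1) y : ℝ) : ℂ) * G y
      = (branch c σ 1 y : ℂ) * G y + (branch c σ (-1) y : ℂ) * G y := fun y => by
    push_cast; ring
  simp only [hsplit]
  refine ⟨i2.add i1, ?_⟩
  have hGc : Continuous fun q => G (vel c σ q) := hG.comp (continuous_vel H)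
  -- The two arcs join to one full period [a, 2π + a], which periodicity then moves to [-π, π].
  rw [integral_add i2 i1, e1, e2, ← mul_add, ← integral_Ioc_eq_integral_Ioo,
    ← integral_Ioc_eq_integral_Ioo, ← intervalIntegral.integral_of_le (by linarith [ha.1]),
    ← intervalIntegral.integral_of_le (by linarith [ha.2]), add_comm,
    intervalIntegral.integral_add_adjacent_intervals (hGc.intervalIntegrable _ _)
      (hGc.intervalIntegrable _ _), add_comm (2 * Real.pi) a]
  have hper : Function.Periodic (fun q => G (vel c σ q)) (2 * Real.pi) := fun q => by
    simp only [vel_add_two_pi]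
  rw [hper.intervalIntegral_add_eq a (-Real.pi), show -Real.pi + 2 * Real.pi = Real.pi by ring]

/-- Lets pointwise claims on (-h, h) be proved in the variable q, choosing the arc by the sign `ε`.
-/
theorem exists_vel_eq {c σ h y : ℝ} (H : Admissible c σ) (E : IsEdge c σ h)
    (hy : y ∈ Ioo (-h) h) (ε : ℝ) (hε : ε = 1 ∨ ε = -1) :
    ∃ q, vel c σ q = y ∧ 0 < ε * critPoly c σ (Real.sin q) := by
  obtain ⟨a, ha, ⟨hn, -, hm1⟩, hp, -, hm2⟩ := exists_arcs H E
  rcases hε with rfl | rfl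
  · rw [← hm2] at hy
    obtain ⟨q, hq, rfl⟩ := hy
    exact ⟨q, rfl, by linarith [hp q hq]⟩
  · rw [← hm1] at hy
    obtain ⟨q, hq, rfl⟩ := hy
    exact ⟨q, rfl, by linarith [hn q hq]⟩

theorem eta_nonneg {c σ h y : ℝ} (H : Admissible c σ) (E : IsEdge c σ h)
    (hy : y ∈ Ioo (-h) h) (ε : ℝ) (hε : ε = 1 ∨ ε = -1) :
    0 ≤ etaBase c σ y + ε * (2 * c * σ * √(quartic c σ y)) := by
  obtain ⟨q, rfl, hq⟩ := exists_vel_eq H E hy ε hε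
  rw [eta_vel H (by rcases hε with rfl | rfl <;> norm_num) hq]
  exact mul_nonneg (sq_nonneg _) (sinSq_pos H q).le

theorem branch_nonneg {c σ h y : ℝ} (H : Admissible c σ) (E : IsEdge c σ h)
    (hy : y ∈ Ioo (-h) h) (ε : ℝ) : 0 ≤ branch c σ ε y := by
  have h1 : y ^ 2 < h ^ 2 := sq_lt_sq' hy.1 hy.2
  have : 0 ≤ 1 - y ^ 2 := by linarith [E.sq_lt, H.lt_one]
  unfold branch
  positivity

/-! ### The parameters of the walk -/

theorem rho0_pos {ρ : ℝ} (hρ : ρ ∈ Ioo (0 : ℝ) 1) : 0 < rho0 ρ :=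
  Real.sqrt_pos.mpr (by nlinarith [hρ.1, hρ.2])

theorem sq_add_rho0_sq {ρ : ℝ} (hρ : ρ ∈ Ioo (0 : ℝ) 1) : ρ ^ 2 + rho0 ρ ^ 2 = 1 := by
  rw [rho0, Real.sq_sqrt (by nlinarith [hρ.1, hρ.2])]; ring

/-- Since ρ² + ρ₀² = 1, c ≤ 1/2 with equality only at ρ = 1/√2. Hence c(1 ± σ) ≤ 1, and equality
forces in addition cos ν = 0, which is the excluded case. -/
theorem admissible {ρ ν : ℝ} (hρ : ρ ∈ Ioo (0 : ℝ) 1)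
    (hne : ∀ n : ℤ, (ρ, ν) ≠ (1 / √2, Real.pi / 2 + n * Real.pi)) :
    Admissible (ρ * rho0 ρ) (Real.sin ν) := by
  have h0 := hρ.1
  have hr := rho0_pos hρ
  have hsum := sq_add_rho0_sq hρ
  have hc : 0 < ρ * rho0 ρ := mul_pos h0 hr
  have hσ := Real.sin_sq_le_one ν
  have h1 := Real.neg_one_le_sin ν
  have h2 := Real.sin_le_one ν
  have hstrict : ρ * rho0 ρ < 1 / 2 ∨ Real.sin ν ^ 2 < 1 := by
    by_contra hcon
    push Not at hcon
    obtain ⟨hc2, hs2⟩ := hcon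
    have heq : ρ = rho0 ρ := by nlinarith [sq_nonneg (ρ - rho0 ρ)]
    have hρ2 : ρ = 1 / √2 := by
      have : ρ ^ 2 = 1 / 2 := by rw [← heq] at hsum; linarith
      rw [← Real.sqrt_sq h0.le, this, Real.sqrt_div zero_le_one, Real.sqrt_one]
    have hcos : Real.cos ν = 0 := by
      have := Real.sin_sq_add_cos_sq ν
      have : Real.cos ν ^ 2 = 0 := by nlinarith [sq_nonneg (Real.cos ν)]
      simpa using this
    obtain ⟨k, hk⟩ := Real.cos_eq_zero_iff.mp hcos
    exact hne k (Prod.ext hρ2 (by rw [hk]; ring))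
  have hhalf : ρ * rho0 ρ ≤ 1 / 2 := by nlinarith [sq_nonneg (ρ - rho0 ρ)]
  refine ⟨hc, ?_, ?_, hσ⟩
  · rcases hstrict with h | h
    · nlinarith
    · have : Real.sin ν < 1 := by nlinarith
      nlinarith
  · rcases hstrict with h | h
    · nlinarith
    · have : -1 < Real.sin ν := by nlinarith
      nlinarith

/-- With p and q the two square roots, p² - q² = 4c, so (p - q)/2 and (p + q)/2 have product c and
are the two positive roots of the quartic. -/
theorem isEdge_of_admissible {c σ : ℝ} (H : Admissible c σ) :
    IsEdge c σ (1 / 2 * (√((1 + c) ^ 2 - c ^ 2 * σ ^ 2) - √((1 - c) ^ 2 - c ^ 2 * σ ^ 2))) := by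
  have hc := H.pos
  have hQ : 0 < (1 - c) ^ 2 - c ^ 2 * σ ^ 2 := by
    nlinarith [mul_pos (sub_pos.mpr H.add) (sub_pos.mpr H.sub)]
  have hPQ : (1 + c) ^ 2 - c ^ 2 * σ ^ 2 = ((1 - c) ^ 2 - c ^ 2 * σ ^ 2) + 4 * c := by ring
  have hP : 0 < (1 + c) ^ 2 - c ^ 2 * σ ^ 2 := by linarith
  have hp2 := Real.sq_sqrt hP.le
  have hq2 := Real.sq_sqrt hQ.le
  have hlt : √((1 - c) ^ 2 - c ^ 2 * σ ^ 2) < √((1 + c) ^ 2 - c ^ 2 * σ ^ 2) :=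
    Real.sqrt_lt_sqrt hQ.le (by linarith)
  have hq0 := Real.sqrt_pos.mpr hQ
  set p := √((1 + c) ^ 2 - c ^ 2 * σ ^ 2)
  set q := √((1 - c) ^ 2 - c ^ 2 * σ ^ 2)
  have hd : p ^ 2 - q ^ 2 = 4 * c := by rw [hp2, hq2]; ring
  refine ⟨by linarith, ?_, ?_⟩
  · nlinarith [mul_pos hq0 (sub_pos.mpr hlt)]
  · have hB : 1 + c ^ 2 * (1 - σ ^ 2) = (p ^ 2 + q ^ 2) / 2 := by rw [hp2, hq2]; ring
    have hcc : c = (p ^ 2 - q ^ 2) / 4 := by linarith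
    rw [quartic, hB]
    rw [show c ^ 2 = ((p ^ 2 - q ^ 2) / 4) ^ 2 by rw [← hcc]]
    ring

theorem isEdge_hstar {ρ ν : ℝ} (H : Admissible (ρ * rho0 ρ) (Real.sin ν)) :
    IsEdge (ρ * rho0 ρ) (Real.sin ν) (hstar ρ ν) := by
  have := isEdge_of_admissible H
  rwa [mul_pow] at this

theorem xi_eq_quartic {ρ : ℝ} (hρ : ρ ∈ Ioo (0 : ℝ) 1) (ν y : ℝ) :
    xi ρ ν y = quartic (ρ * rho0 ρ) (Real.sin ν) y := by
  rw [xi, quartic, Real.cos_sq']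
  linear_combination (-y ^ 2) * sq_add_rho0_sq hρ

theorem etaPlus_eq {ρ : ℝ} (hρ : ρ ∈ Ioo (0 : ℝ) 1) (ν y : ℝ) :
    etaPlus ρ ν y = etaBase (ρ * rho0 ρ) (Real.sin ν) y
      + 1 * (2 * (ρ * rho0 ρ) * Real.sin ν * √(quartic (ρ * rho0 ρ) (Real.sin ν) y)) := by
  rw [etaPlus, etaBase, ← xi_eq_quartic hρ, Real.cos_sq']
  ring

theorem etaMinus_eq {ρ : ℝ} (hρ : ρ ∈ Ioo (0 : ℝ) 1) (ν y : ℝ) :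
    etaMinus ρ ν y = etaBase (ρ * rho0 ρ) (Real.sin ν) y
      + -1 * (2 * (ρ * rho0 ρ) * Real.sin ν * √(quartic (ρ * rho0 ρ) (Real.sin ν) y)) := by
  rw [etaMinus, etaBase, ← xi_eq_quartic hρ, Real.cos_sq']
  ring

theorem density_eq_indicator {ρ : ℝ} (hρ : ρ ∈ Ioo (0 : ℝ) 1) (ν : ℝ) (α β : ℂ) :
    density ρ ν α β = (Ioo (-hstar ρ ν) (hstar ρ ν)).indicator fun y =>
      (branch (ρ * rho0 ρ) (Real.sin ν) 1 y + branch (ρ * rho0 ρ) (Real.sin ν) (-1) y)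
        * gam ρ ν α β y := by
  unfold density
  congr 1
  funext y
  rw [branch, branch, etaPlus_eq hρ, etaMinus_eq hρ, xi_eq_quartic hρ, add_div]

theorem continuous_gam (ρ ν : ℝ) (α β : ℂ) : Continuous (gam ρ ν α β) := by
  unfold gam; fun_prop

theorem density_mul_eq_indicator {ρ : ℝ} (hρ : ρ ∈ Ioo (0 : ℝ) 1) (ν : ℝ) (α β : ℂ)
    (g : ℝ → ℂ) :
    (fun y => (density ρ ν α β y : ℂ) * g y) = (Ioo (-hstar ρ ν) (hstar ρ ν)).indicator fun y =>
      ((branch (ρ * rho0 ρ) (Real.sin ν) 1 y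
        + branch (ρ * rho0 ρ) (Real.sin ν) (-1) y : ℝ) : ℂ) * (gam ρ ν α β y * g y) := by
  funext y
  rw [density_eq_indicator hρ]
  by_cases hy : y ∈ Ioo (-hstar ρ ν) (hstar ρ ν)
  · simp only [indicator_of_mem hy]
    push_cast
    ring
  · simp [indicator_of_notMem hy]

/-- Identifies the measure with the limit density as the image under the group velocity of γ(v(q))
dq/2π. -/
theorem integral_density_mul {ρ ν : ℝ} (hρ : ρ ∈ Ioo (0 : ℝ) 1)
    (H : Admissible (ρ * rho0 ρ) (Real.sin ν)) (α β : ℂ) {g : ℝ → ℂ} (hg : Continuous g) :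
    Integrable (fun y => (density ρ ν α β y : ℂ) * g y) ∧
      ∫ y, (density ρ ν α β y : ℂ) * g y
        = 1 / (2 * Real.pi) * ∫ q in -Real.pi..Real.pi,
          (gam ρ ν α β (vel (ρ * rho0 ρ) (Real.sin ν) q) : ℂ)
            * g (vel (ρ * rho0 ρ) (Real.sin ν) q) := by
  have hG : Continuous fun y => (gam ρ ν α β y : ℂ) * g y :=
    (Complex.continuous_ofReal.comp (continuous_gam ρ ν α β)).mul hg
  obtain ⟨h1, h2⟩ := integral_branches_mul H (isEdge_hstar H) hG
  rw [density_mul_eq_indicator hρ, integrable_indicator_iff measurableSet_Ioo,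
    integral_indicator measurableSet_Ioo]
  exact ⟨h1, h2⟩

/-! ### The walk in Fourier space -/

/-- The Fourier symbol of the evolution operator `U` at the phase `z = e^{-ik}`. -/
noncomputable def symbol (ρ ν : ℝ) (z : ℂ) : Matrix (Fin 2) (Fin 2) ℂ :=
  !![-(alpha0 ρ ν * rho0 ρ) * (1 + z), -(1 - (rho0 ρ : ℂ) ^ 2) + (rho0 ρ : ℂ) ^ 2 * z;
     -(1 - (rho0 ρ : ℂ) ^ 2) + (rho0 ρ : ℂ) ^ 2 * z⁻¹, rho0 ρ * conj (alpha0 ρ ν) * (1 + z⁻¹)]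

theorem hasSum_zpow_mul_shift {z : ℂ} (hz : z ≠ 0) {a : ℤ → ℂ} {s : ℂ}
    (h : HasSum (fun x : ℤ => z ^ x * a x) s) (j : ℤ) :
    HasSum (fun x : ℤ => z ^ x * a (x + j)) (z ^ (-j) * s) := by
  have h1 := (Equiv.addRight j).hasSum_iff.mpr (h.mul_left (z ^ (-j)))
  refine h1.congr_fun fun x => ?_
  simp only [Function.comp_apply, Equiv.coe_addRight]
  rw [← mul_assoc, ← zpow_add₀ hz]
  congr 2
  ring

theorem hasSum_zpow_mul_U {ρ ν : ℝ} {z : ℂ} (hz : z ≠ 0) {ψ : State} {w : Fin 2 → ℂ}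
    (h : ∀ i, HasSum (fun x : ℤ => z ^ x * ψ x i) (w i)) (i : Fin 2) :
    HasSum (fun x : ℤ => z ^ x * U ρ ν ψ x i) ((symbol ρ ν z).mulVec w i) := by
  have hm : ∀ i, HasSum (fun x : ℤ => z ^ x * ψ (x - 1) i) (z * w i) := fun i => by
    simpa [sub_eq_add_neg] using hasSum_zpow_mul_shift (a := fun x => ψ x i) hz (h i) (-1)
  have hp : ∀ i, HasSum (fun x : ℤ => z ^ x * ψ (x + 1) i) (z⁻¹ * w i) := fun i => by
    simpa using hasSum_zpow_mul_shift (a := fun x => ψ x i) hz (h i) 1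
  fin_cases i
  · have := ((((h 0).add (hm 0)).mul_left (-(alpha0 ρ ν * rho0 ρ))).sub
      ((h 1).mul_left (1 - (rho0 ρ : ℂ) ^ 2))).add ((hm 1).mul_left ((rho0 ρ : ℂ) ^ 2))
    convert! this using 1
    · funext x
      simp only [Fin.zero_eta, U_apply_zero]
      ring
    · simp [symbol, Matrix.mulVec, dotProduct, Fin.sum_univ_two]
      ring
  · have := ((((h 1).add (hp 1)).mul_left (rho0 ρ * conj (alpha0 ρ ν))).sub
      ((h 0).mul_left (1 - (rho0 ρ : ℂ) ^ 2))).add ((hp 0).mul_left ((rho0 ρ : ℂ) ^ 2))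
    convert! this using 1
    · funext x
      simp only [Fin.mk_one, U_apply_one]
      ring
    · simp [symbol, Matrix.mulVec, dotProduct, Fin.sum_univ_two]
      ring

theorem Psi_succ (ρ ν : ℝ) (α β : ℂ) (t : ℕ) :
    Psi ρ ν α β (t + 1) = U ρ ν (Psi ρ ν α β t) := by
  rw [Psi, pow_succ', mul_apply_eq_comp]; rfl

theorem Psi_zero_apply (ρ ν : ℝ) (α β : ℂ) (x : ℤ) (i : Fin 2) :
    Psi ρ ν α β 0 x i = if x = 0 then ![α, β] i else 0 := by
  rw [Psi, pow_zero, one_apply_eq_self, initial]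
  by_cases hx : x = 0
  · subst hx; simp
  · rw [lp.single_apply_ne _ _ _ hx]; simp [hx]

theorem hasSum_zpow_mul_Psi (ρ ν : ℝ) (α β : ℂ) {z : ℂ} (hz : z ≠ 0) (t : ℕ) (i : Fin 2) :
    HasSum (fun x : ℤ => z ^ x * Psi ρ ν α β t x i)
      ((symbol ρ ν z ^ t).mulVec ![α, β] i) := by
  induction t generalizing i with
  | zero =>
    have := hasSum_single (f := fun x : ℤ => z ^ x * Psi ρ ν α β 0 x i) 0
      (fun x hx => by simp [Psi_zero_apply, hx])
    simpa [Psi_zero_apply] using this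
  | succ t ih =>
    rw [Psi_succ, pow_succ', ← Matrix.mulVec_mulVec]
    exact hasSum_zpow_mul_U hz ih i

/-- One step moves amplitude by at most one site. The Fourier series are therefore finite sums and
can be integrated term by term. -/
theorem Psi_apply_eq_zero (ρ ν : ℝ) (α β : ℂ) (t : ℕ) (x : ℤ) (hx : (t : ℤ) < |x|) (i : Fin 2) :
    Psi ρ ν α β t x i = 0 := by
  induction t generalizing x i with
  | zero =>
    have : x ≠ 0 := by rintro rfl; simp at hx
    simp [Psi_zero_apply, this]
  | succ t ih =>
    push_cast at hx
    rw [Psi_succ]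
    have h0 := ih x (by omega)
    have h1 := ih (x - 1) (by grind)
    have h2 := ih (x + 1) (by grind)
    fin_cases i
    · simp [U_apply_zero, h0, h1]
    · simp [U_apply_one, h0, h2]

theorem sum_zpow_mul_Psi (ρ ν : ℝ) (α β : ℂ) {z : ℂ} (hz : z ≠ 0) (t : ℕ) (i : Fin 2) :
    ∑ x ∈ Finset.Icc (-(t : ℤ)) t, z ^ x * Psi ρ ν α β t x i
      = (symbol ρ ν z ^ t).mulVec ![α, β] i := by
  refine HasSum.unique (hasSum_sum_of_ne_finset_zero fun x hx => ?_)
    (hasSum_zpow_mul_Psi ρ ν α β hz t i)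
  rw [Psi_apply_eq_zero, mul_zero]
  rw [Finset.mem_Icc, ← abs_le] at hx
  omega

/-! ### Parseval's identity and the characteristic function of the position -/

/-- The phase `e^{-ik}`. -/
noncomputable def phase (k : ℝ) : ℂ := Complex.exp (-(k * Complex.I))

theorem phase_ne_zero (k : ℝ) : phase k ≠ 0 := Complex.exp_ne_zero _

theorem conj_phase (k : ℝ) : conj (phase k) = (phase k)⁻¹ := by
  rw [phase, ← Complex.exp_conj, ← Complex.exp_neg]
  simp

theorem continuous_phase : Continuous phase := by unfold phase; fun_prop

theorem phase_sub (k h : ℝ) : phase (k - h) = phase k * (phase h)⁻¹ := by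
  rw [phase, phase, phase, ← Complex.exp_neg, ← Complex.exp_add]
  congr 1
  push_cast
  ring

theorem integral_phase_zpow (n : ℤ) :
    ∫ k in -Real.pi..Real.pi, phase k ^ n = if n = 0 then (2 * Real.pi : ℂ) else 0 := by
  split_ifs with hn
  · subst hn; simp; ring
  · have hc : -(n * Complex.I) ≠ 0 := by simp [hn]
    have : ∀ k : ℝ, phase k ^ n = Complex.exp (-(n * Complex.I) * k) := fun k => by
      rw [phase, ← Complex.exp_int_mul]; congr 1; ring
    simp only [this]
    rw [integral_exp_mul_complex hc, div_eq_zero_iff]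
    left
    rw [sub_eq_zero, Complex.exp_eq_exp_iff_exists_int]
    exact ⟨-n, by push_cast; ring⟩

/-- Parseval with a shift: moving the momentum by h multiplies the amplitude at y by e^{ihy}, and
orthogonality of the phases leaves the diagonal terms. -/
theorem integral_conj_sum_mul_sum (S : Finset ℤ) (a : ℤ → ℂ) (h : ℝ) :
    ∫ k in -Real.pi..Real.pi, conj (∑ x ∈ S, phase k ^ x * a x)
        * ∑ y ∈ S, phase (k - h) ^ y * a y
      = 2 * Real.pi * ∑ x ∈ S, (‖a x‖ ^ 2 : ℂ) * (phase h)⁻¹ ^ x := by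
  have hexp : ∀ k : ℝ, conj (∑ x ∈ S, phase k ^ x * a x) * ∑ y ∈ S, phase (k - h) ^ y * a y
      = ∑ x ∈ S, ∑ y ∈ S, (conj (a x) * a y * (phase h)⁻¹ ^ y) * phase k ^ (y - x) := fun k => by
    rw [map_sum, Finset.sum_mul_sum]
    refine Finset.sum_congr rfl fun x _ => Finset.sum_congr rfl fun y _ => ?_
    rw [map_mul, map_zpow₀, conj_phase, phase_sub, mul_zpow, zpow_sub₀ (phase_ne_zero k),
      inv_zpow]
    ring
  have hcont : ∀ n : ℤ, Continuous fun k => phase k ^ n := fun n =>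
    continuous_phase.zpow₀ n fun k => Or.inl (phase_ne_zero k)
  simp only [hexp]
  have hterm : ∀ x y : ℤ, Continuous fun k =>
      (conj (a x) * a y * (phase h)⁻¹ ^ y) * phase k ^ (y - x) := fun x y =>
    continuous_const.mul (hcont (y - x))
  rw [intervalIntegral.integral_finsetSum, Finset.mul_sum]
  swap
  · exact fun x _ => (continuous_finsetSum _ fun y _ => hterm x y).intervalIntegrable _ _
  refine Finset.sum_congr rfl fun x hx => ?_
  rw [intervalIntegral.integral_finsetSum fun y _ => (hterm x y).intervalIntegrable _ _]
  simp only [intervalIntegral.integral_const_mul, integral_phase_zpow, sub_eq_zero]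
  simp only [mul_ite, mul_zero, Finset.sum_ite_eq', hx, if_true]
  rw [← Complex.conj_mul']
  ring

theorem norm_sq_apply_eq_sum (ψ : State) (x : ℤ) : ‖ψ x‖ ^ 2 = ∑ i, ‖ψ x i‖ ^ 2 :=
  EuclideanSpace.norm_sq_eq _

/-- The overlap `⟨Û(k)^t φ, Û(k-h)^t φ⟩` of evolved states in Fourier space. -/
noncomputable def overlap (ρ ν : ℝ) (α β : ℂ) (t : ℕ) (k h : ℝ) : ℂ :=
  ∑ i, conj ((symbol ρ ν (phase k) ^ t).mulVec ![α, β] i)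
    * (symbol ρ ν (phase (k - h)) ^ t).mulVec ![α, β] i

theorem continuous_symbol_phase (ρ ν : ℝ) : Continuous fun k => symbol ρ ν (phase k) := by
  have h1 := continuous_phase
  have h2 : Continuous fun k => (phase k)⁻¹ := h1.inv₀ phase_ne_zero
  refine continuous_matrix fun i j => ?_
  fin_cases i <;> fin_cases j <;> simp [symbol] <;> fun_prop

theorem continuous_overlap (ρ ν : ℝ) (α β : ℂ) (t : ℕ) (h : ℝ) :
    Continuous fun k => overlap ρ ν α β t k h := by
  have h1 : ∀ i, Continuous fun k => (symbol ρ ν (phase k) ^ t).mulVec ![α, β] i := fun i =>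
    (continuous_apply i).comp
      (((continuous_symbol_phase ρ ν).pow t).matrix_mulVec continuous_const)
  unfold overlap
  exact continuous_finsetSum _ fun i _ => (Complex.continuous_conj.comp (h1 i)).mul
    ((h1 i).comp (continuous_id.sub continuous_const))

theorem integral_overlap (ρ ν : ℝ) (α β : ℂ) (t : ℕ) (h : ℝ) :
    ∫ k in -Real.pi..Real.pi, overlap ρ ν α β t k h
      = 2 * Real.pi * ∑ x ∈ Finset.Icc (-(t : ℤ)) t,
        ((‖Psi ρ ν α β t x‖ ^ 2 : ℝ) : ℂ) * (phase h)⁻¹ ^ x := by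
  have h1 : ∀ i, Continuous fun k => (symbol ρ ν (phase k) ^ t).mulVec ![α, β] i := fun i =>
    (continuous_apply i).comp
      (((continuous_symbol_phase ρ ν).pow t).matrix_mulVec continuous_const)
  unfold overlap
  rw [intervalIntegral.integral_finsetSum]
  swap
  · exact fun i _ => ((Complex.continuous_conj.comp (h1 i)).mul
      ((h1 i).comp (continuous_id.sub continuous_const))).intervalIntegrable _ _
  simp only [← sum_zpow_mul_Psi ρ ν α β (phase_ne_zero _)]
  simp only [integral_conj_sum_mul_sum]
  rw [← Finset.mul_sum, Finset.sum_comm]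
  congr 1
  refine Finset.sum_congr rfl fun x _ => ?_
  rw [norm_sq_apply_eq_sum, ← Finset.sum_mul]
  push_cast
  rfl

theorem law_real_singleton (ρ ν : ℝ) (hρ : ρ ∈ Ioo (0 : ℝ) 1) (α β : ℂ)
    (h : ‖α‖ ^ 2 + ‖β‖ ^ 2 = 1) (t : ℕ) (x : ℤ) :
    (law ρ ν hρ α β h t : Measure ℤ).real {x} = ‖Psi ρ ν α β t x‖ ^ 2 := by
  change (Measure.sum fun x : ℤ => ENNReal.ofReal (‖Psi ρ ν α β t x‖ ^ 2) •
    Measure.dirac x).real {x} = _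
  rw [Measure.real, Measure.sum_apply _ (measurableSet_singleton x), tsum_eq_single x]
  · simp
  · intro y hy
    simp [hy]

/-- The shift u/t produces the factors e^{iux/t}. At t = 0 both quotients by t are 0 by convention,
so the formula needs no exception. -/
theorem charFun_law (ρ ν : ℝ) (hρ : ρ ∈ Ioo (0 : ℝ) 1) (α β : ℂ)
    (h : ‖α‖ ^ 2 + ‖β‖ ^ 2 = 1) (t : ℕ) (u : ℝ) :
    charFun ((law ρ ν hρ α β h t : Measure ℤ).map fun n : ℤ => (n : ℝ) / (t : ℝ)) u
      = 1 / (2 * Real.pi) * ∫ k in -Real.pi..Real.pi, overlap ρ ν α β t k (u / t) := by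
  rw [integral_overlap, charFun_apply_real, integral_map .of_discrete (by fun_prop)]
  have hint : Integrable (fun n : ℤ => Complex.exp (u * ((n : ℝ) / (t : ℝ) : ℝ) * Complex.I))
      (law ρ ν hρ α β h t : Measure ℤ) := by
    refine Integrable.of_bound .of_discrete 1 (ae_of_all _ fun n => ?_)
    rw [← Complex.ofReal_mul, Complex.norm_exp_ofReal_mul_I]
  rw [integral_countable hint]
  simp only [law_real_singleton]
  rw [tsum_eq_sum (s := Finset.Icc (-(t : ℤ)) t)]
  · have hpi : (Real.pi : ℂ) ≠ 0 := by exact_mod_cast Real.pi_ne_zero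
    rw [← mul_assoc, one_div, inv_mul_cancel₀ (by simp [hpi]), one_mul]
    refine Finset.sum_congr rfl fun x _ => ?_
    rw [Complex.real_smul, phase, ← Complex.exp_neg, ← Complex.exp_int_mul]
    congr 2
    push_cast
    ring
  · intro x hx
    rw [Finset.mem_Icc, ← abs_le] at hx
    have : ‖Psi ρ ν α β t x‖ ^ 2 = 0 := by
      rw [norm_sq_apply_eq_sum]
      exact Finset.sum_eq_zero fun i _ => by
        rw [Psi_apply_eq_zero ρ ν α β t x (by omega)]; simp
    rw [this, zero_smul]

/-! ### Spectral decomposition of the symbol -/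

/-- The eigenphase `θ` with `cos θ = -c (σ + sin q)`. -/
noncomputable def eigenphase (c σ q : ℝ) : ℝ := Real.arccos (-(c * (σ + Real.sin q)))

theorem cos_eigenphase {c σ : ℝ} (H : Admissible c σ) (q : ℝ) :
    Real.cos (eigenphase c σ q) = -(c * (σ + Real.sin q)) := by
  have h := abs_lt.mp (abs_dispersion_lt_one H q)
  exact Real.cos_arccos (by linarith [h.2]) (by linarith [h.1])

theorem sin_eigenphase (c σ q : ℝ) : Real.sin (eigenphase c σ q) = √(sinSq c σ q) := by
  rw [eigenphase, Real.sin_arccos, sinSq]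
  congr 1
  ring

theorem hasDerivAt_eigenphase {c σ : ℝ} (H : Admissible c σ) (q : ℝ) :
    HasDerivAt (eigenphase c σ) (vel c σ q) q := by
  have h := abs_lt.mp (abs_dispersion_lt_one H q)
  have h1 : HasDerivAt (fun q => -(c * (σ + Real.sin q))) (-(c * Real.cos q)) q :=
    (((Real.hasDerivAt_sin q).const_add σ).const_mul c).neg
  have h2 := (Real.hasDerivAt_arccos (x := -(c * (σ + Real.sin q))) (by linarith [h.2])
    (by linarith [h.1])).comp q h1
  convert! h2 using 1
  rw [vel, sinSq, show (-(c * (σ + Real.sin q))) ^ 2 = c ^ 2 * (σ + Real.sin q) ^ 2 by ring]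
  ring

/-- The diagonal entry of the Hermitian involution commuting with the symbol. -/
noncomputable def reflDiag (ρ ν q : ℝ) : ℝ :=
  ρ * rho0 ρ * (Real.cos ν + Real.cos q) / √(sinSq (ρ * rho0 ρ) (Real.sin ν) q)

/-- The off-diagonal entry of the Hermitian involution commuting with the symbol. -/
noncomputable def reflOff (ρ ν q : ℝ) : ℂ :=
  ((ρ : ℂ) ^ 2 - (rho0 ρ : ℂ) ^ 2 * ((Real.cos ν - Complex.I * Real.sin ν)
    * (Real.cos q + Complex.I * Real.sin q))) / (√(sinSq (ρ * rho0 ρ) (Real.sin ν) q) : ℝ)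

/-- The Hermitian involution `N` with `Û = i (cos θ + i sin θ N)`. -/
noncomputable def refl (ρ ν q : ℝ) : Matrix (Fin 2) (Fin 2) ℂ :=
  !![(reflDiag ρ ν q : ℂ), reflOff ρ ν q; conj (reflOff ρ ν q), -(reflDiag ρ ν q : ℂ)]

theorem phase_sub_eq (ν q : ℝ) :
    phase (ν - q) = (Real.cos ν - Complex.I * Real.sin ν)
      * (Real.cos q + Complex.I * Real.sin q) := by
  have h1 : phase (ν - q) = Complex.exp ((-ν : ℝ) * Complex.I) * Complex.exp (q * Complex.I) := by
    rw [phase, ← Complex.exp_add]; congr 1; push_cast; ring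
  rw [h1, Complex.exp_mul_I, Complex.exp_mul_I]
  push_cast
  rw [Complex.cos_neg, Complex.sin_neg]
  ring

theorem alpha0_eq (ρ ν : ℝ) : alpha0 ρ ν = ρ * (Real.cos ν + Complex.I * Real.sin ν) := by
  rw [alpha0, mul_comm Complex.I, Complex.exp_mul_I]
  push_cast
  ring

/-- At k = ν - q the symbol has trace -2ic(σ + sin q), a function of sin q alone; this is the reason
for the change of momentum variable. -/
theorem symbol_eq {ρ ν : ℝ} (hρ : ρ ∈ Ioo (0 : ℝ) 1)
    (H : Admissible (ρ * rho0 ρ) (Real.sin ν)) (q : ℝ) :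
    symbol ρ ν (phase (ν - q)) = Complex.I •
      ((Real.cos (eigenphase (ρ * rho0 ρ) (Real.sin ν) q) : ℂ) • 1
        + (Complex.I * Real.sin (eigenphase (ρ * rho0 ρ) (Real.sin ν) q)) • refl ρ ν q) := by
  have hs : ((√(sinSq (ρ * rho0 ρ) (Real.sin ν) q) : ℝ) : ℂ) ≠ 0 := by
    exact_mod_cast (Real.sqrt_pos.mpr (sinSq_pos H q)).ne'
  have hsum : (ρ : ℂ) ^ 2 + (rho0 ρ : ℂ) ^ 2 = 1 := by exact_mod_cast sq_add_rho0_sq hρ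
  have hν : (Real.sin ν : ℂ) ^ 2 + (Real.cos ν : ℂ) ^ 2 = 1 := by
    exact_mod_cast Real.sin_sq_add_cos_sq ν
  have hI := Complex.I_sq
  rw [cos_eigenphase H, sin_eigenphase, symbol, ← conj_phase, phase_sub_eq, alpha0_eq, refl,
    reflOff, reflDiag]
  set s := √(sinSq (ρ * rho0 ρ) (Real.sin ν) q)
  set r := rho0 ρ
  set C := Real.cos ν
  set S := Real.sin ν
  set x := Real.cos q
  set y := Real.sin q
  have hI4 : Complex.I ^ 4 = 1 := Complex.I_pow_four
  have hI3 : Complex.I ^ 3 = -Complex.I := Complex.I_pow_three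
  ext i j
  fin_cases i <;> fin_cases j <;> simp <;> field_simp <;>
    simp only [mul_add, mul_sub, add_mul, sub_mul] <;> ring_nf <;> simp only [hI, hI3, hI4]
  · linear_combination (-(ρ : ℂ) * r * (x + Complex.I * y)) * hν
  · linear_combination hsum
  · linear_combination hsum
  · linear_combination ((ρ : ℂ) * r * (x - Complex.I * y)) * hν

theorem reflDiag_sq_add {ρ ν : ℝ} (hρ : ρ ∈ Ioo (0 : ℝ) 1)
    (H : Admissible (ρ * rho0 ρ) (Real.sin ν)) (q : ℝ) :
    (reflDiag ρ ν q : ℂ) ^ 2 + reflOff ρ ν q * conj (reflOff ρ ν q) = 1 := by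
  have hD := sinSq_pos H q
  have hs : ((√(sinSq (ρ * rho0 ρ) (Real.sin ν) q) : ℝ) : ℂ) ≠ 0 := by
    exact_mod_cast (Real.sqrt_pos.mpr hD).ne'
  have hs2 : ((√(sinSq (ρ * rho0 ρ) (Real.sin ν) q) : ℝ) : ℂ) ^ 2
      = 1 - (ρ : ℂ) ^ 2 * (rho0 ρ : ℂ) ^ 2 * (Real.sin ν + Real.sin q) ^ 2 := by
    rw [← Complex.ofReal_pow, Real.sq_sqrt hD.le, sinSq]; push_cast; ring
  have hsum : (rho0 ρ : ℂ) ^ 2 = 1 - (ρ : ℂ) ^ 2 := by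
    rw [eq_sub_iff_add_eq']; exact_mod_cast sq_add_rho0_sq hρ
  have hν : (Real.cos ν : ℂ) ^ 2 = 1 - (Real.sin ν : ℂ) ^ 2 := by
    rw [eq_sub_iff_add_eq']; exact_mod_cast Real.sin_sq_add_cos_sq ν
  have hq : (Real.cos q : ℂ) ^ 2 = 1 - (Real.sin q : ℂ) ^ 2 := by
    rw [eq_sub_iff_add_eq']; exact_mod_cast Real.sin_sq_add_cos_sq q
  have hI := Complex.I_sq
  rw [reflOff, reflDiag]
  simp only [map_div₀, map_sub, map_mul, map_add, map_pow, Complex.conj_ofReal, Complex.conj_I,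
    Complex.ofReal_div, Complex.ofReal_mul, Complex.ofReal_add]
  set s := √(sinSq (ρ * rho0 ρ) (Real.sin ν) q)
  set r := rho0 ρ
  set C := Real.cos ν
  set S := Real.sin ν
  set x := Real.cos q
  set y := Real.sin q
  set J := Complex.I
  -- The numerator of `reflOff` is ρ² - ρ₀²e^{i(q-ν)}: `e1` and `e2` say that the exponentials have
  -- modulus one, `e3` gives twice the real part of their product, `e4` the squared modulus.
  have e1 : ((C : ℂ) - J * S) * (C - -J * S) = 1 := by
    linear_combination hν - (S : ℂ) ^ 2 * hI
  have e2 : ((x : ℂ) + J * y) * (x + -J * y) = 1 := by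
    linear_combination hq - (y : ℂ) ^ 2 * hI
  have e3 : ((C : ℂ) - J * S) * (x + J * y) + (C - -J * S) * (x + -J * y)
      = 2 * (C * x + S * y) := by
    linear_combination (-2 * S * y : ℂ) * hI
  have e4 : ((ρ : ℂ) ^ 2 - (r : ℂ) ^ 2 * ((C - J * S) * (x + J * y)))
      * ((ρ : ℂ) ^ 2 - (r : ℂ) ^ 2 * ((C - -J * S) * (x + -J * y)))
      = (ρ : ℂ) ^ 4 + (r : ℂ) ^ 4 - 2 * (ρ : ℂ) ^ 2 * (r : ℂ) ^ 2 * (C * x + S * y) := by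
    linear_combination (r : ℂ) ^ 4 * e1 * ((x + J * y) * (x + -J * y)) + (r : ℂ) ^ 4 * e2
      - (ρ : ℂ) ^ 2 * (r : ℂ) ^ 2 * e3
  rw [div_pow, div_mul_div_comm, ← sq, ← add_div, e4, hs2, div_eq_one_iff_eq (by
    rw [← hs2]; exact pow_ne_zero 2 hs)]
  have hr4 : (r : ℂ) ^ 4 = (1 - (ρ : ℂ) ^ 2) ^ 2 := by rw [← hsum]; ring
  rw [hr4, mul_pow, mul_pow, hsum]
  linear_combination (ρ : ℂ) ^ 2 * (1 - (ρ : ℂ) ^ 2) * (hν + hq)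

theorem refl_mul_self {ρ ν : ℝ} (hρ : ρ ∈ Ioo (0 : ℝ) 1)
    (H : Admissible (ρ * rho0 ρ) (Real.sin ν)) (q : ℝ) : refl ρ ν q * refl ρ ν q = 1 := by
  have h := reflDiag_sq_add hρ H q
  ext i j
  fin_cases i <;> fin_cases j <;> simp [refl, Matrix.mul_apply, Fin.sum_univ_two]
  · linear_combination h
  · ring
  · ring
  · linear_combination h

/-- De Moivre's formula, with iN in the role of the imaginary unit since (iN)² = -1. -/
theorem smul_rotation_pow {N : Matrix (Fin 2) (Fin 2) ℂ} (hN : N * N = 1) (θ : ℝ) (t : ℕ) :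
    (Complex.I • ((Real.cos θ : ℂ) • (1 : Matrix (Fin 2) (Fin 2) ℂ)
        + (Complex.I * Real.sin θ) • N)) ^ t
      = Complex.I ^ t • ((Real.cos (t * θ) : ℂ) • 1 + (Complex.I * Real.sin (t * θ)) • N) := by
  rw [smul_pow]
  congr 1
  induction t with
  | zero => simp
  | succ t ih =>
    rw [pow_succ, ih]
    simp only [add_mul, mul_add, smul_mul_assoc, mul_smul_comm, one_mul, mul_one, hN]
    push_cast
    rw [add_mul, one_mul, Complex.cos_add, Complex.sin_add]
    have hI := Complex.I_mul_I
    match_scalars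
    · linear_combination Complex.sin (t * θ) * Complex.sin θ * hI
    · ring

/-! ### Overlaps in terms of the spectral decomposition -/

/-- The vector `N φ` for `φ = (α, β)`. -/
noncomputable def reflVec (ρ ν : ℝ) (α β : ℂ) (q : ℝ) : Fin 2 → ℂ :=
  ![reflDiag ρ ν q * α + reflOff ρ ν q * β, conj (reflOff ρ ν q) * α - reflDiag ρ ν q * β]

/-- The expectation `⟨φ, N φ⟩` for `φ = (α, β)`. -/
noncomputable def reflMean (ρ ν : ℝ) (α β : ℂ) (q : ℝ) : ℝ :=
  (‖α‖ ^ 2 - ‖β‖ ^ 2) * reflDiag ρ ν q + 2 * (conj α * β * reflOff ρ ν q).re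

theorem sum_conj_mul_reflVec (ρ ν : ℝ) (α β : ℂ) (q : ℝ) :
    ∑ i, conj (![α, β] i) * reflVec ρ ν α β q i = reflMean ρ ν α β q := by
  have h : ((2 * (conj α * β * reflOff ρ ν q).re : ℝ) : ℂ)
      = conj α * β * reflOff ρ ν q + α * conj β * conj (reflOff ρ ν q) := by
    rw [← Complex.add_conj]
    simp
  rw [reflMean, Complex.ofReal_add, h]
  simp only [Fin.sum_univ_two, reflVec, Matrix.cons_val_zero, Matrix.cons_val_one,
    Complex.ofReal_mul, Complex.ofReal_sub, Complex.ofReal_pow, ← Complex.mul_conj']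
  ring

theorem sum_conj_reflVec_mul (ρ ν : ℝ) (α β : ℂ) (q : ℝ) :
    ∑ i, conj (reflVec ρ ν α β q i) * ![α, β] i = reflMean ρ ν α β q := by
  rw [← Complex.conj_ofReal, ← sum_conj_mul_reflVec, map_sum]
  refine Finset.sum_congr rfl fun i _ => ?_
  rw [map_mul, Complex.conj_conj, mul_comm]

theorem sum_conj_mul_self {α β : ℂ} (h : ‖α‖ ^ 2 + ‖β‖ ^ 2 = 1) :
    ∑ i, conj (![α, β] i) * ![α, β] i = 1 := by
  simp only [Fin.sum_univ_two, Matrix.cons_val_zero, Matrix.cons_val_one, Complex.conj_mul']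
  exact_mod_cast h

theorem sum_conj_reflVec_mul_reflVec {ρ ν : ℝ} (hρ : ρ ∈ Ioo (0 : ℝ) 1)
    (H : Admissible (ρ * rho0 ρ) (Real.sin ν)) {α β : ℂ} (h : ‖α‖ ^ 2 + ‖β‖ ^ 2 = 1) (q : ℝ) :
    ∑ i, conj (reflVec ρ ν α β q i) * reflVec ρ ν α β q i = 1 := by
  rw [← sum_conj_mul_self h]
  simp only [Fin.sum_univ_two, reflVec, Matrix.cons_val_zero, Matrix.cons_val_one, map_add,
    map_sub, map_mul, Complex.conj_ofReal, Complex.conj_conj]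
  linear_combination (conj α * α + conj β * β) * reflDiag_sq_add hρ H q

theorem abs_reflMean_le {ρ ν : ℝ} (hρ : ρ ∈ Ioo (0 : ℝ) 1)
    (H : Admissible (ρ * rho0 ρ) (Real.sin ν)) {α β : ℂ} (h : ‖α‖ ^ 2 + ‖β‖ ^ 2 = 1) (q : ℝ) :
    |reflMean ρ ν α β q| ≤ 1 := by
  -- Expands ‖φ + eNφ‖² ≥ 0 for e = ±1, using that φ and Nφ are unit vectors.
  have key : ∀ e : ℝ, e ^ 2 = 1 → 0 ≤ 2 + 2 * e * reflMean ρ ν α β q := fun e he => by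
    have heC : (e : ℂ) ^ 2 = 1 := by exact_mod_cast he
    have h1 : ((∑ i, ‖![α, β] i + e * reflVec ρ ν α β q i‖ ^ 2 : ℝ) : ℂ)
        = ((2 + 2 * e * reflMean ρ ν α β q : ℝ) : ℂ) := by
      have e1 := sum_conj_mul_self h
      have e2 := sum_conj_reflVec_mul_reflVec hρ H h q
      have e3 := sum_conj_mul_reflVec ρ ν α β q
      have e4 := sum_conj_reflVec_mul ρ ν α β q
      rw [Fin.sum_univ_two] at e1 e2 e3 e4 ⊢
      generalize (![α, β] : Fin 2 → ℂ) = v at *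
      push_cast
      rw [← Complex.conj_mul', ← Complex.conj_mul']
      simp only [map_add, map_mul, Complex.conj_ofReal]
      linear_combination e1 + e2 + e * e3 + e * e4
        + (conj (reflVec ρ ν α β q 0) * reflVec ρ ν α β q 0
          + conj (reflVec ρ ν α β q 1) * reflVec ρ ν α β q 1) * heC
    rw [← Complex.ofReal_injective h1]
    positivity
  have h1 := key 1 (by norm_num)
  have h2 := key (-1) (by norm_num)
  exact abs_le.mpr ⟨by linarith, by linarith⟩

theorem symbol_pow_mulVec {ρ ν : ℝ} (hρ : ρ ∈ Ioo (0 : ℝ) 1)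
    (H : Admissible (ρ * rho0 ρ) (Real.sin ν)) (α β : ℂ) (q : ℝ) (t : ℕ) (i : Fin 2) :
    (symbol ρ ν (phase (ν - q)) ^ t).mulVec ![α, β] i = Complex.I ^ t *
      (Real.cos (t * eigenphase (ρ * rho0 ρ) (Real.sin ν) q) * ![α, β] i
        + Complex.I * Real.sin (t * eigenphase (ρ * rho0 ρ) (Real.sin ν) q)
          * reflVec ρ ν α β q i) := by
  have hv : (refl ρ ν q).mulVec ![α, β] = reflVec ρ ν α β q := by
    ext i
    fin_cases i <;> simp [refl, reflVec, Matrix.mulVec, dotProduct, Fin.sum_univ_two]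
    ring
  rw [symbol_eq hρ H, smul_rotation_pow (refl_mul_self hρ H q), Matrix.smul_mulVec,
    Matrix.add_mulVec, Matrix.smul_mulVec, Matrix.smul_mulVec, Matrix.one_mulVec, hv]
  simp only [Pi.smul_apply, Pi.add_apply, smul_eq_mul]

/-- Writing N(q + s)φ as N(q)φ plus a difference isolates two terms that depend only on the phase
difference, hence converge for s = u/t. The factors oscillating with tθ multiply only that
difference, which tends to 0. -/
theorem overlap_eq {ρ ν : ℝ} (hρ : ρ ∈ Ioo (0 : ℝ) 1)
    (H : Admissible (ρ * rho0 ρ) (Real.sin ν)) {α β : ℂ} (h : ‖α‖ ^ 2 + ‖β‖ ^ 2 = 1)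
    (t : ℕ) (q s : ℝ) :
    overlap ρ ν α β t (ν - q) s =
      (Real.cos (t * (eigenphase (ρ * rho0 ρ) (Real.sin ν) (q + s)
          - eigenphase (ρ * rho0 ρ) (Real.sin ν) q)) : ℂ)
      + Complex.I * reflMean ρ ν α β q
        * Real.sin (t * (eigenphase (ρ * rho0 ρ) (Real.sin ν) (q + s)
          - eigenphase (ρ * rho0 ρ) (Real.sin ν) q))
      + Complex.I * (Real.cos (t * eigenphase (ρ * rho0 ρ) (Real.sin ν) q)
          * Real.sin (t * eigenphase (ρ * rho0 ρ) (Real.sin ν) (q + s)) : ℝ)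
        * ∑ i, conj (![α, β] i) * (reflVec ρ ν α β (q + s) i - reflVec ρ ν α β q i)
      + (Real.sin (t * eigenphase (ρ * rho0 ρ) (Real.sin ν) q)
          * Real.sin (t * eigenphase (ρ * rho0 ρ) (Real.sin ν) (q + s)) : ℝ)
        * ∑ i, conj (reflVec ρ ν α β q i)
          * (reflVec ρ ν α β (q + s) i - reflVec ρ ν α β q i) := by
  have e1 := sum_conj_mul_self h
  have e2 := sum_conj_reflVec_mul_reflVec hρ H h q
  have e3 := sum_conj_mul_reflVec ρ ν α β q
  have e4 := sum_conj_reflVec_mul ρ ν α β q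
  have hIt : conj (Complex.I ^ t) * Complex.I ^ t = 1 := by
    rw [map_pow, ← mul_pow, Complex.conj_I, neg_mul, Complex.I_mul_I, neg_neg, one_pow]
  rw [overlap, show ν - q - s = ν - (q + s) by ring]
  simp only [symbol_pow_mulVec hρ H]
  rw [mul_sub, Real.cos_sub, Real.sin_sub]
  rw [Fin.sum_univ_two] at e1 e2 e3 e4
  simp only [Fin.sum_univ_two, map_mul, map_add, Complex.conj_ofReal, Complex.conj_I]
  generalize eigenphase (ρ * rho0 ρ) (Real.sin ν) q = θ
  generalize eigenphase (ρ * rho0 ρ) (Real.sin ν) (q + s) = θ'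
  generalize reflVec ρ ν α β (q + s) = w'
  generalize reflVec ρ ν α β q = w at *
  generalize (![α, β] : Fin 2 → ℂ) = v at *
  push_cast
  generalize Complex.cos (t * θ) = a
  generalize Complex.sin (t * θ) = b
  generalize Complex.cos (t * θ') = a'
  generalize Complex.sin (t * θ') = b'
  set J := Complex.I
  have hJ : J ^ 2 = -1 := Complex.I_sq
  linear_combination
    ((a * conj (v 0) - J * b * conj (w 0)) * (a' * v 0 + J * b' * w' 0)
      + (a * conj (v 1) - J * b * conj (w 1)) * (a' * v 1 + J * b' * w' 1)) * hIt
    + a * a' * e1 + b * b' * e2 + J * a * b' * e3 - J * b * a' * e4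
    - b * b' * (conj (w 0) * w' 0 + conj (w 1) * w' 1) * hJ

/-! ### The limit of the characteristic functions -/

theorem continuous_reflDiag {ρ ν : ℝ} (H : Admissible (ρ * rho0 ρ) (Real.sin ν)) :
    Continuous (reflDiag ρ ν) := by
  unfold reflDiag
  exact (by fun_prop : Continuous fun q => ρ * rho0 ρ * (Real.cos ν + Real.cos q)).div
    (continuous_sinSq _ _).sqrt fun q => (Real.sqrt_pos.mpr (sinSq_pos H q)).ne'

theorem continuous_reflOff {ρ ν : ℝ} (H : Admissible (ρ * rho0 ρ) (Real.sin ν)) :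
    Continuous (reflOff ρ ν) := by
  unfold reflOff
  refine Continuous.div (by fun_prop)
    (Complex.continuous_ofReal.comp (continuous_sinSq _ _).sqrt) fun q => ?_
  exact Complex.ofReal_ne_zero.mpr (Real.sqrt_pos.mpr (sinSq_pos H q)).ne'

theorem continuous_reflVec {ρ ν : ℝ} (H : Admissible (ρ * rho0 ρ) (Real.sin ν)) (α β : ℂ) :
    Continuous (reflVec ρ ν α β) := by
  have h1 := continuous_reflDiag H
  have h2 := continuous_reflOff H
  refine continuous_pi fun i => ?_
  fin_cases i <;> simp [reflVec] <;> fun_prop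

theorem continuous_reflMean {ρ ν : ℝ} (H : Admissible (ρ * rho0 ρ) (Real.sin ν)) (α β : ℂ) :
    Continuous (reflMean ρ ν α β) := by
  have h1 := continuous_reflDiag H
  have h2 := continuous_reflOff H
  unfold reflMean
  fun_prop

/-- The pointwise limit of the overlaps at the momentum shift `u / t`. -/
noncomputable def limitOverlap (ρ ν : ℝ) (α β : ℂ) (u q : ℝ) : ℂ :=
  (Real.cos (vel (ρ * rho0 ρ) (Real.sin ν) q * u) : ℂ)
    + Complex.I * reflMean ρ ν α β q * Real.sin (vel (ρ * rho0 ρ) (Real.sin ν) q * u)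

theorem tendsto_mul_sub_div_of_hasDerivAt {f : ℝ → ℝ} {f' x : ℝ} (hf : HasDerivAt f f' x) (u : ℝ) :
    Tendsto (fun t : ℕ => (t : ℝ) * (f (x + u / t) - f x)) atTop (𝓝 (f' * u)) := by
  have h1 : HasDerivAt (fun s => f (x + u * s)) (f' * u) 0 := by
    have h2 : HasDerivAt (fun s => x + u * s) u 0 := by
      simpa using ((hasDerivAt_id (0 : ℝ)).const_mul u).const_add x
    have h3 : HasDerivAt f f' (x + u * 0) := by simpa using hf
    exact h3.comp 0 h2
  have h4 := hasDerivAt_iff_tendsto_slope_zero.mp h1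
  have h5 : Tendsto (fun t : ℕ => ((t : ℝ))⁻¹) atTop (𝓝[≠] 0) := by
    rw [tendsto_nhdsWithin_iff]
    refine ⟨tendsto_inv_atTop_nhds_zero_nat, ?_⟩
    filter_upwards [eventually_gt_atTop 0] with t ht
    exact inv_ne_zero (Nat.cast_ne_zero.mpr ht.ne')
  refine (h4.comp h5).congr fun t => ?_
  simp [div_eq_mul_inv]

theorem tendsto_ofReal_mul_of_abs_le_one {b : ℕ → ℝ} (hb : ∀ t, |b t| ≤ 1) {w : ℕ → ℂ}
    (hw : Tendsto w atTop (𝓝 0)) : Tendsto (fun t => (b t : ℂ) * w t) atTop (𝓝 0) := by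
  refine squeeze_zero_norm (fun t => ?_) (tendsto_zero_iff_norm_tendsto_zero.mp hw)
  rw [norm_mul, Complex.norm_real, Real.norm_eq_abs]
  exact mul_le_of_le_one_left (norm_nonneg _) (hb t)

theorem tendsto_overlap {ρ ν : ℝ} (hρ : ρ ∈ Ioo (0 : ℝ) 1)
    (H : Admissible (ρ * rho0 ρ) (Real.sin ν)) {α β : ℂ} (h : ‖α‖ ^ 2 + ‖β‖ ^ 2 = 1)
    (u q : ℝ) :
    Tendsto (fun t : ℕ => overlap ρ ν α β t (ν - q) (u / t)) atTop
      (𝓝 (limitOverlap ρ ν α β u q)) := by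
  have hθ := tendsto_mul_sub_div_of_hasDerivAt (hasDerivAt_eigenphase H q) u
  have hs : Tendsto (fun t : ℕ => q + u / (t : ℝ)) atTop (𝓝 q) := by
    simpa using (tendsto_const_div_atTop_nhds_zero_nat u).const_add q
  have hw : ∀ i, Tendsto
      (fun t : ℕ => reflVec ρ ν α β (q + u / t) i - reflVec ρ ν α β q i) atTop (𝓝 0) := fun i => by
    have := ((continuous_apply i).comp (continuous_reflVec H α β)).continuousAt.tendsto.comp hs
    simpa using this.sub_const (reflVec ρ ν α β q i)
  have hsum : ∀ v : Fin 2 → ℂ, Tendsto (fun t : ℕ => ∑ i, conj (v i)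
      * (reflVec ρ ν α β (q + u / t) i - reflVec ρ ν α β q i)) atTop (𝓝 0) := fun v => by
    simpa using tendsto_finsetSum Finset.univ fun i _ => (hw i).const_mul (conj (v i))
  have habs : ∀ x y : ℝ, |x| ≤ 1 → |y| ≤ 1 → |x * y| ≤ 1 := fun x y hx hy => by
    rw [abs_mul]; exact mul_le_one₀ hx (abs_nonneg _) hy
  simp only [overlap_eq hρ H h]
  have hcos := (Complex.continuous_ofReal.tendsto _).comp ((Real.continuous_cos.tendsto _).comp hθ)
  have hsin := (Complex.continuous_ofReal.tendsto _).comp ((Real.continuous_sin.tendsto _).comp hθ)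
  have h3 := (tendsto_ofReal_mul_of_abs_le_one (fun t : ℕ => habs _ _
    (Real.abs_cos_le_one (t * eigenphase (ρ * rho0 ρ) (Real.sin ν) q))
    (Real.abs_sin_le_one (t * eigenphase (ρ * rho0 ρ) (Real.sin ν) (q + u / t))))
    (hsum ![α, β])).const_mul Complex.I
  have h4 := tendsto_ofReal_mul_of_abs_le_one (fun t : ℕ => habs _ _
    (Real.abs_sin_le_one (t * eigenphase (ρ * rho0 ρ) (Real.sin ν) q))
    (Real.abs_sin_le_one (t * eigenphase (ρ * rho0 ρ) (Real.sin ν) (q + u / t))))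
    (hsum (reflVec ρ ν α β q))
  have := ((hcos.add (hsin.const_mul (Complex.I * reflMean ρ ν α β q))).add h3).add h4
  simp only [mul_zero, add_zero] at this
  refine this.congr fun t => ?_
  simp only [Function.comp_apply, mul_assoc]

theorem norm_symbol_pow_mulVec_le {ρ ν : ℝ} (hρ : ρ ∈ Ioo (0 : ℝ) 1)
    (H : Admissible (ρ * rho0 ρ) (Real.sin ν)) {α β : ℂ} (h : ‖α‖ ^ 2 + ‖β‖ ^ 2 = 1)
    (q : ℝ) (t : ℕ) (i : Fin 2) :
    ‖(symbol ρ ν (phase (ν - q)) ^ t).mulVec ![α, β] i‖ ≤ 2 := by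
  have hle : ∀ v : Fin 2 → ℂ, ∑ i, conj (v i) * v i = 1 → ∀ i, ‖v i‖ ≤ 1 := fun v hv i => by
    have h1 : ∑ i, ‖v i‖ ^ 2 = 1 := by
      simp only [Complex.conj_mul'] at hv
      exact_mod_cast hv
    have h2 := Finset.single_le_sum (fun i _ => sq_nonneg ‖v i‖) (Finset.mem_univ i)
    rw [h1] at h2
    nlinarith [norm_nonneg (v i)]
  have h1 := hle _ (sum_conj_mul_self h) i
  have h2 := hle _ (sum_conj_reflVec_mul_reflVec hρ H h q) i
  rw [symbol_pow_mulVec hρ H, norm_mul, norm_pow, Complex.norm_I, one_pow, one_mul]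
  refine (norm_add_le _ _).trans ?_
  rw [norm_mul, norm_mul, norm_mul, Complex.norm_I, one_mul, Complex.norm_real,
    Complex.norm_real, Real.norm_eq_abs, Real.norm_eq_abs]
  have h3 := mul_le_one₀ (Real.abs_cos_le_one (t * eigenphase (ρ * rho0 ρ) (Real.sin ν) q))
    (norm_nonneg _) h1
  have h4 := mul_le_one₀ (Real.abs_sin_le_one (t * eigenphase (ρ * rho0 ρ) (Real.sin ν) q))
    (norm_nonneg _) h2
  linarith

/-- A crude bound from two components, each at most 2·2; dominated convergence only needs
independence of t and k. -/
theorem norm_overlap_le {ρ ν : ℝ} (hρ : ρ ∈ Ioo (0 : ℝ) 1)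
    (H : Admissible (ρ * rho0 ρ) (Real.sin ν)) {α β : ℂ} (h : ‖α‖ ^ 2 + ‖β‖ ^ 2 = 1)
    (t : ℕ) (k s : ℝ) : ‖overlap ρ ν α β t k s‖ ≤ 8 := by
  have hb : ∀ k i, ‖(symbol ρ ν (phase k) ^ t).mulVec ![α, β] i‖ ≤ 2 := fun k i => by
    simpa using norm_symbol_pow_mulVec_le hρ H h (ν - k) t i
  unfold overlap
  refine (norm_sum_le _ _).trans ?_
  have : ∀ i, ‖conj ((symbol ρ ν (phase k) ^ t).mulVec ![α, β] i)
      * (symbol ρ ν (phase (k - s)) ^ t).mulVec ![α, β] i‖ ≤ 4 := fun i => by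
    rw [norm_mul, RCLike.norm_conj]
    nlinarith [hb k i, hb (k - s) i, norm_nonneg ((symbol ρ ν (phase k) ^ t).mulVec ![α, β] i),
      norm_nonneg ((symbol ρ ν (phase (k - s)) ^ t).mulVec ![α, β] i)]
  rw [Fin.sum_univ_two]
  linarith [this 0, this 1]

theorem integral_comp_sub_left_of_periodic {f : ℝ → ℂ}
    (hf : Function.Periodic f (2 * Real.pi)) (d : ℝ) :
    ∫ q in -Real.pi..Real.pi, f (d - q) = ∫ q in -Real.pi..Real.pi, f q := by
  rw [intervalIntegral.integral_comp_sub_left]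
  have := hf.intervalIntegral_add_eq (d - Real.pi) (-Real.pi)
  rwa [show d - Real.pi + 2 * Real.pi = d - -Real.pi by ring,
    show -Real.pi + 2 * Real.pi = Real.pi by ring] at this

theorem overlap_periodic (ρ ν : ℝ) (α β : ℂ) (t : ℕ) (s : ℝ) :
    Function.Periodic (fun k => overlap ρ ν α β t k s) (2 * Real.pi) := fun k => by
  have hp : ∀ k, phase (k + 2 * Real.pi) = phase k := fun k => by
    rw [phase, phase, Complex.exp_eq_exp_iff_exists_int]
    exact ⟨-1, by push_cast; ring⟩
  simp only [overlap, hp, add_sub_right_comm]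

theorem tendsto_charFun_law {ρ ν : ℝ} (hρ : ρ ∈ Ioo (0 : ℝ) 1)
    (H : Admissible (ρ * rho0 ρ) (Real.sin ν)) {α β : ℂ} (h : ‖α‖ ^ 2 + ‖β‖ ^ 2 = 1) (u : ℝ) :
    Tendsto (fun t : ℕ =>
        charFun ((law ρ ν hρ α β h t : Measure ℤ).map fun n : ℤ => (n : ℝ) / (t : ℝ)) u) atTop
      (𝓝 (1 / (2 * Real.pi) * ∫ q in -Real.pi..Real.pi, limitOverlap ρ ν α β u q)) := by
  simp only [charFun_law]
  refine Tendsto.const_mul _ ?_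
  -- Substitutes k = ν - q, the variable in which the spectral decomposition is available.
  simp only [fun t : ℕ =>
    (integral_comp_sub_left_of_periodic (overlap_periodic ρ ν α β t (u / t)) ν).symm]
  refine intervalIntegral.tendsto_integral_filter_of_dominated_convergence (fun _ => 8)
    (Eventually.of_forall fun t => ?_) (Eventually.of_forall fun t => ae_of_all _ fun q _ =>
      norm_overlap_le hρ H h t _ _) intervalIntegrable_const
    (ae_of_all _ fun q _ => tendsto_overlap hρ H h u q)
  exact ((continuous_overlap ρ ν α β t _).comp
    (continuous_const.sub continuous_id)).aestronglyMeasurable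

/-! ### Symmetrisation -/

/-- The reflection fixes sin q and flips cos q, so only terms in cos q survive, and these are
multiples of v. The ratio ρ₀/ρ in γ comes from the factor ρ₀² in `reflOff` against ρρ₀ in v. -/
theorem reflMean_sub_reflMean {ρ : ℝ} (hρ : ρ ∈ Ioo (0 : ℝ) 1) (ν : ℝ) (α β : ℂ) (q : ℝ) :
    reflMean ρ ν α β q - reflMean ρ ν α β (Real.pi - q)
      = 2 * (gam ρ ν α β (vel (ρ * rho0 ρ) (Real.sin ν) q) - 1) := by
  have hs : sinSq (ρ * rho0 ρ) (Real.sin ν) (Real.pi - q) = sinSq (ρ * rho0 ρ) (Real.sin ν) q := by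
    simp [sinSq]
  have hρ0 := hρ.1.ne'
  have hoff : ∀ z : ℂ, (z * reflOff ρ ν q).re - (z * reflOff ρ ν (Real.pi - q)).re
      = -2 * rho0 ρ ^ 2 * Real.cos q * (z.re * Real.cos ν + z.im * Real.sin ν)
        / √(sinSq (ρ * rho0 ρ) (Real.sin ν) q) := fun z => by
    rw [← Complex.sub_re, ← mul_sub, reflOff, reflOff, hs, ← sub_div, ← mul_div_assoc,
      Complex.div_ofReal_re, Real.cos_pi_sub, Real.sin_pi_sub]
    congr 1
    simp [-Complex.ofReal_cos, -Complex.ofReal_sin, ← Complex.ofReal_pow]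
    ring
  have h1 : reflMean ρ ν α β q - reflMean ρ ν α β (Real.pi - q)
      = (‖α‖ ^ 2 - ‖β‖ ^ 2) * (reflDiag ρ ν q - reflDiag ρ ν (Real.pi - q))
        + 2 * ((conj α * β * reflOff ρ ν q).re
          - (conj α * β * reflOff ρ ν (Real.pi - q)).re) := by
    rw [reflMean, reflMean]; ring
  rw [h1, hoff, reflDiag, reflDiag, hs, Real.cos_pi_sub, gam, vel]
  simp only [Complex.mul_re, Complex.mul_im, Complex.conj_re, Complex.conj_im]
  field_simp
  ring

theorem gam_vel_nonneg {ρ ν : ℝ} (hρ : ρ ∈ Ioo (0 : ℝ) 1)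
    (H : Admissible (ρ * rho0 ρ) (Real.sin ν)) {α β : ℂ} (h : ‖α‖ ^ 2 + ‖β‖ ^ 2 = 1) (q : ℝ) :
    0 ≤ gam ρ ν α β (vel (ρ * rho0 ρ) (Real.sin ν) q) := by
  have h1 := abs_le.mp (abs_reflMean_le hρ H h q)
  have h2 := abs_le.mp (abs_reflMean_le hρ H h (Real.pi - q))
  linarith [reflMean_sub_reflMean hρ ν α β q, h1.1, h2.2]

theorem gam_neg (ρ ν : ℝ) (α β : ℂ) (y : ℝ) :
    gam ρ ν α β (-y) = 2 - gam ρ ν α β y := by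
  unfold gam; ring

/-- An integral over a period sees only the part invariant under q ↦ π - q. -/
theorem integral_eq_of_symm {F G : ℝ → ℂ} (hF : Continuous F) (hG : Continuous G)
    (pF : Function.Periodic F (2 * Real.pi)) (pG : Function.Periodic G (2 * Real.pi))
    (h : ∀ q, F q + F (Real.pi - q) = G q + G (Real.pi - q)) :
    ∫ q in -Real.pi..Real.pi, F q = ∫ q in -Real.pi..Real.pi, G q := by
  have key : ∀ K : ℝ → ℂ, Continuous K → Function.Periodic K (2 * Real.pi) →
      ∫ q in -Real.pi..Real.pi, (K q + K (Real.pi - q)) = 2 * ∫ q in -Real.pi..Real.pi, K q := by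
    intro K hK pK
    have hK' : Continuous fun q => K (Real.pi - q) :=
      hK.comp (continuous_const.sub continuous_id)
    rw [intervalIntegral.integral_add (hK.intervalIntegrable _ _) (hK'.intervalIntegrable _ _),
      integral_comp_sub_left_of_periodic pK, two_mul]
  have h1 := key F hF pF
  rw [intervalIntegral.integral_congr fun q _ => h q, key G hG pG] at h1
  exact (mul_left_cancel₀ two_ne_zero h1).symm

theorem integral_limitOverlap {ρ ν : ℝ} (hρ : ρ ∈ Ioo (0 : ℝ) 1)
    (H : Admissible (ρ * rho0 ρ) (Real.sin ν)) (α β : ℂ) (u : ℝ) :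
    ∫ q in -Real.pi..Real.pi, limitOverlap ρ ν α β u q
      = ∫ q in -Real.pi..Real.pi, (gam ρ ν α β (vel (ρ * rho0 ρ) (Real.sin ν) q) : ℂ)
        * Complex.exp (u * vel (ρ * rho0 ρ) (Real.sin ν) q * Complex.I) := by
  have hv := continuous_vel H
  have hn := continuous_reflMean H α β
  have hg := continuous_gam ρ ν α β
  have pn : ∀ q, reflMean ρ ν α β (q + 2 * Real.pi) = reflMean ρ ν α β q := fun q => by
    simp [reflMean, reflDiag, reflOff, sinSq]
  refine integral_eq_of_symm ?_ (by fun_prop) (fun q => ?_) (fun q => ?_) fun q => ?_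
  · unfold limitOverlap; fun_prop
  · simp only [limitOverlap, vel_add_two_pi, pn]
  · simp only [vel_add_two_pi]
  -- Both symmetrised integrands equal 2cos(uv) + 2i(γ(v) - 1)sin(uv).
  · have hr := reflMean_sub_reflMean hρ ν α β q
    have hrC : (reflMean ρ ν α β q : ℂ) - reflMean ρ ν α β (Real.pi - q)
      = 2 * (gam ρ ν α β (vel (ρ * rho0 ρ) (Real.sin ν) q) - 1) := by exact_mod_cast hr
    rw [limitOverlap, limitOverlap, vel_pi_sub, gam_neg]
    generalize vel (ρ * rho0 ρ) (Real.sin ν) q = v at *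
    rw [← Complex.ofReal_mul, ← Complex.ofReal_mul, Complex.exp_mul_I, Complex.exp_mul_I,
      neg_mul, mul_neg, mul_comm u v, Real.cos_neg, Real.sin_neg]
    push_cast
    rw [Complex.cos_neg, Complex.sin_neg]
    linear_combination Complex.I * Complex.sin (v * u) * hrC

/-! ### The limit law -/

theorem density_nonneg {ρ ν : ℝ} (hρ : ρ ∈ Ioo (0 : ℝ) 1)
    (H : Admissible (ρ * rho0 ρ) (Real.sin ν)) {α β : ℂ} (h : ‖α‖ ^ 2 + ‖β‖ ^ 2 = 1) (y : ℝ) :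
    0 ≤ density ρ ν α β y := by
  have E := isEdge_hstar H
  rw [density_eq_indicator hρ]
  refine indicator_nonneg (fun y hy => ?_) y
  obtain ⟨q, rfl, -⟩ := exists_vel_eq H E hy 1 (Or.inl rfl)
  exact mul_nonneg (add_nonneg (branch_nonneg H E hy _) (branch_nonneg H E hy _))
    (gam_vel_nonneg hρ H h q)

theorem integrable_density {ρ ν : ℝ} (hρ : ρ ∈ Ioo (0 : ℝ) 1)
    (H : Admissible (ρ * rho0 ρ) (Real.sin ν)) (α β : ℂ) : Integrable (density ρ ν α β) := by
  have h1 := (integral_density_mul hρ H α β (g := fun _ => 1) continuous_const).1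
  simpa using h1.re

theorem integral_density {ρ ν : ℝ} (hρ : ρ ∈ Ioo (0 : ℝ) 1)
    (H : Admissible (ρ * rho0 ρ) (Real.sin ν)) (α β : ℂ) : ∫ y, density ρ ν α β y = 1 := by
  -- Total mass is the case u = 0, where `limitOverlap` is 1. The test function 1 is written as an
  -- exponential to match `integral_limitOverlap`.
  have h1 := (integral_density_mul hρ H α β (g := fun y => Complex.exp ((0 : ℝ) * y * Complex.I))
    (by fun_prop)).2
  rw [← integral_limitOverlap hρ H] at h1
  simp only [Complex.ofReal_zero, zero_mul, Complex.exp_zero, mul_one, limitOverlap, mul_zero,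
    Real.cos_zero, Real.sin_zero, add_zero, Complex.ofReal_one] at h1
  rw [intervalIntegral.integral_const, integral_complex_ofReal] at h1
  have hpi : (Real.pi : ℂ) ≠ 0 := by exact_mod_cast Real.pi_ne_zero
  have h2 : ((∫ y, density ρ ν α β y : ℝ) : ℂ) = 1 := by
    rw [h1, Complex.real_smul]
    push_cast
    field_simp
    norm_num
  exact_mod_cast h2

theorem limitLaw_apply {ρ ν : ℝ} (hρ : ρ ∈ Ioo (0 : ℝ) 1)
    (H : Admissible (ρ * rho0 ρ) (Real.sin ν)) {α β : ℂ} (h : ‖α‖ ^ 2 + ‖β‖ ^ 2 = 1)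
    {s : Set ℝ} (hs : MeasurableSet s) :
    limitLaw ρ ν α β s = ENNReal.ofReal (∫ y in s, density ρ ν α β y) := by
  rw [limitLaw, withDensity_apply _ hs, ofReal_integral_eq_lintegral_ofReal
    (integrable_density hρ H α β).integrableOn (ae_of_all _ (density_nonneg hρ H h))]

theorem isProbabilityMeasure_limitLaw {ρ ν : ℝ} (hρ : ρ ∈ Ioo (0 : ℝ) 1)
    (H : Admissible (ρ * rho0 ρ) (Real.sin ν)) {α β : ℂ} (h : ‖α‖ ^ 2 + ‖β‖ ^ 2 = 1) :
    IsProbabilityMeasure (limitLaw ρ ν α β) :=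
  ⟨by rw [limitLaw_apply hρ H h MeasurableSet.univ, setIntegral_univ, integral_density hρ H,
    ENNReal.ofReal_one]⟩

theorem charFun_limitLaw {ρ ν : ℝ} (hρ : ρ ∈ Ioo (0 : ℝ) 1)
    (H : Admissible (ρ * rho0 ρ) (Real.sin ν)) {α β : ℂ} (h : ‖α‖ ^ 2 + ‖β‖ ^ 2 = 1) (u : ℝ) :
    charFun (limitLaw ρ ν α β) u
      = 1 / (2 * Real.pi) * ∫ q in -Real.pi..Real.pi, limitOverlap ρ ν α β u q := by
  rw [integral_limitOverlap hρ H, ← (integral_density_mul hρ H α β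
    (g := fun y => Complex.exp (u * y * Complex.I)) (by fun_prop)).2, charFun_apply_real,
    limitLaw, integral_withDensity_eq_integral_toReal_smul₀
      (integrable_density hρ H α β).aemeasurable.ennreal_ofReal
      (ae_of_all _ fun _ => ENNReal.ofReal_lt_top)]
  refine integral_congr_ae (ae_of_all _ fun y => ?_)
  simp only [ENNReal.toReal_ofReal (density_nonneg hρ H h y), Complex.real_smul]

theorem tendstoInDistribution_law {ρ ν : ℝ} (hρ : ρ ∈ Ioo (0 : ℝ) 1)
    (H : Admissible (ρ * rho0 ρ) (Real.sin ν)) {α β : ℂ} (h : ‖α‖ ^ 2 + ‖β‖ ^ 2 = 1)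
    [IsProbabilityMeasure (limitLaw ρ ν α β)] :
    TendstoInDistribution (fun (t : ℕ) (n : ℤ) => (n : ℝ) / (t : ℝ)) atTop id
      (fun t : ℕ => (law ρ ν hρ α β h t : Measure ℤ)) (limitLaw ρ ν α β) where
  forall_aemeasurable _ := .of_discrete
  tendsto := by
    refine ProbabilityMeasure.tendsto_iff_tendsto_charFun.mpr fun u => ?_
    simp only [ProbabilityMeasure.coe_mk, Measure.map_id]
    rw [charFun_limitLaw hρ H h]
    exact tendsto_charFun_law hρ H h u

theorem tendsto_law_real_setOf_le {ρ ν : ℝ} (hρ : ρ ∈ Ioo (0 : ℝ) 1)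
    (H : Admissible (ρ * rho0 ρ) (Real.sin ν)) {α β : ℂ} (h : ‖α‖ ^ 2 + ‖β‖ ^ 2 = 1) (x : ℝ) :
    Tendsto (fun t : ℕ => (law ρ ν hρ α β h t : Measure ℤ).real {n : ℤ | (n : ℝ) / (t : ℝ) ≤ x})
      atTop (𝓝 (∫ y in Iic x, density ρ ν α β y)) := by
  have := isProbabilityMeasure_limitLaw hρ H h
  have hT := (tendstoInDistribution_law hρ H h).tendsto
  -- The limit law has a density, so the boundary point x carries no mass and every half-line is a
  -- continuity set.
  have hnull : (limitLaw ρ ν α β).map id (frontier (Iic x)) = 0 := by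
    rw [Measure.map_id, frontier_Iic]
    exact withDensity_absolutelyContinuous _ _ Real.volume_singleton
  have h1 := ProbabilityMeasure.tendsto_measure_of_null_frontier_of_tendsto' hT hnull
  simp only [ProbabilityMeasure.coe_mk, Measure.map_id,
    limitLaw_apply hρ H h measurableSet_Iic] at h1
  have h2 := (ENNReal.tendsto_toReal ENNReal.ofReal_ne_top).comp h1
  rw [ENNReal.toReal_ofReal (integral_nonneg (density_nonneg hρ H h))] at h2
  refine h2.congr fun t => ?_
  rw [Function.comp_apply, Measure.map_apply .of_discrete measurableSet_Iic]
  rfl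

end QWalk

theorem theorem1 (ρ ν : ℝ) (hρ : ρ ∈ Set.Ioo (0 : ℝ) 1)
    (hne : ∀ n : ℤ, (ρ, ν) ≠ (1 / √2, Real.pi / 2 + n * Real.pi))
    (α β : ℂ) (hαβ : ‖α‖ ^ 2 + ‖β‖ ^ 2 = 1) :
    -- the square roots and quotients in the limit density are genuine on `(-h*, h*)`
    (0 < QWalk.hstar ρ ν ∧ QWalk.hstar ρ ν < 1 ∧
      ∀ y ∈ Set.Ioo (-QWalk.hstar ρ ν) (QWalk.hstar ρ ν),
        0 < QWalk.xi ρ ν y ∧ 0 ≤ QWalk.etaPlus ρ ν y ∧ 0 ≤ QWalk.etaMinus ρ ν y) ∧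
    -- the limit density is a probability density
    (∀ y : ℝ, 0 ≤ QWalk.density ρ ν α β y) ∧
    MeasureTheory.Integrable (QWalk.density ρ ν α β) ∧
    ∫ y : ℝ, QWalk.density ρ ν α β y = 1 ∧
    -- convergence of the distribution functions of `X_t / t`
    (∀ x : ℝ, Filter.Tendsto
      (fun t : ℕ => (QWalk.law ρ ν hρ α β hαβ t : MeasureTheory.Measure ℤ).real
        {n : ℤ | (n : ℝ) / (t : ℝ) ≤ x})
      Filter.atTop (nhds (∫ y in Set.Iic x, QWalk.density ρ ν α β y))) ∧
    -- convergence in distribution of `X_t / t`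
    (∃ _ : MeasureTheory.IsProbabilityMeasure (QWalk.limitLaw ρ ν α β),
      MeasureTheory.TendstoInDistribution (fun (t : ℕ) (n : ℤ) => (n : ℝ) / (t : ℝ)) Filter.atTop id
        (fun t : ℕ => (QWalk.law ρ ν hρ α β hαβ t : MeasureTheory.Measure ℤ))
        (QWalk.limitLaw ρ ν α β)) := by
  have H := QWalk.admissible hρ hne
  have E := QWalk.isEdge_hstar H
  have hP := QWalk.isProbabilityMeasure_limitLaw hρ H hαβ
  refine ⟨⟨E.pos, ?_, fun y hy => ⟨?_, ?_, ?_⟩⟩, QWalk.density_nonneg hρ H hαβ,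
    QWalk.integrable_density hρ H α β, QWalk.integral_density hρ H α β,
    QWalk.tendsto_law_real_setOf_le hρ H hαβ, hP, QWalk.tendstoInDistribution_law hρ H hαβ⟩
  · nlinarith [E.sq_lt, H.lt_one, E.pos]
  · rw [QWalk.xi_eq_quartic hρ]
    exact QWalk.quartic_pos E hy
  · rw [QWalk.etaPlus_eq hρ]
    exact QWalk.eta_nonneg H E hy 1 (Or.inl rfl)
  · rw [QWalk.etaMinus_eq hρ]
    exact QWalk.eta_nonneg H E hy (-1) (Or.inr rfl)
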